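/- Let $F$ be a field of characteristic zero and let $\underline{\mathrm{Rep}}(S_0)=\underline{\mathrm{Rep}}(S_0;F)$ be Deligne's category at parameter $t=0$. That is, it is the Karoubi (idempotent) envelope of the additive envelope of the $F$-linear category whose objects $[A]$ are the finite sets $A$ (write $[n]$ if $A$ has $n$ elements), where $\operatorname{Hom}([A],[B])$ is the $F$-vector space with basis the partition diagrams on $A\sqcup B$ (set partitions of $A\sqcup B$). The composite of two diagrams is $t^{\ell}=0^{\ell}$ times the diagram obtained by stacking them, where $\ell$ is the number of connected components of the stacking that lie entirely in the middle row (and $0^0=1$). It is an $F$-linear symmetric ribbon category with $F=\operatorname{End}(\mathbb 1)$: the tensor product is disjoint union (juxtaposition of diagrams), the unit is $[0]$, the braiding is given by the diagram of the swap, each $[A]$ is its own dual, with $\operatorname{coev}$ and $\operatorname{ev}$ the diagrams whose blocks are the pairs of equal elements of the two copies of $A$, and the twist $\theta$ is the identity. In a ribbon category $\mathcal C$ with braiding $c$ and twist $\theta$ put $\operatorname{ev}'_W=\operatorname{ev}_W\circ c_{W,W^*}\circ(\theta_W\otimes \mathrm{Id}_{W^*}):W\otimes W^*\to\mathbb 1$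 and, for $f\in\operatorname{End}(V\otimes W)$, $$\operatorname{tr}_R(f)=(\mathrm{Id}_V\otimes \operatorname{ev}'_W)\circ(f\otimes \mathrm{Id}_{W^*})\circ(\mathrm{Id}_V\otimes\operatorname{coev}_W)\in\operatorname{End}(V).$$ An ideal of $\mathcal C$ is a full subcategory closed under $V\mapsto V\otimes W$ for every object $W$ of $\mathcal C$ and under retracts. For an object $J$, let $\mathcal I_J$ be the ideal of all retracts of objects $J\otimes X$ with $X$ in $\mathcal C$. A trace on an ideal $\mathcal I$ of an $F$-linear ribbon category with $\operatorname{End}(\mathbb 1)=F$ is a family of $F$-linear functions $\mathsf t=\{\mathsf t_V:\operatorname{End}(V)\to F\}_{V\in\mathcal I}$ such that 1. $\mathsf t_{U\otimes W}(f)=\mathsf t_U(\operatorname{tr}_R(f))$ for all $U\in\mathcal I$, all objects $W$ of $\mathcal C$ and all $f\in\operatorname{End}(U\otimes W)$; 2. $\mathsf t_V(g\circ f)=\mathsf t_U(f\circ g)$ for all $U,V\in\mathcal I$, $f:V\to U$ and $g:U\to V$. Let $L(\Box)$ be the indecomposable object of $\underline{\mathrm{Rep}}(S_0)$ attached to the Young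 diagram with one box; it is defined up to isomorphism as the image $([1],e)$ of a primitive idempotent $e$ of the partition algebra $FP_1(0)=\operatorname{End}([1])$ whose image under the projection $FP_1(0)\to FS_1=F$ (the coefficient of the identity diagram) is nonzero. **Theorem.** There is a unique trace $\mathsf t=\{\mathsf t_V\}_{V\in\mathcal I_{L(\Box)}}$ on the ideal $\mathcal I_{L(\Box)}$ of $\underline{\mathrm{Rep}}(S_0)$ such that $\mathsf t_{L(\Box)}(\mathrm{id}_{L(\Box)})=1$. -/

import Mathlib

open CategoryTheory MonoidalCategory

universe u v w

noncomputable section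

/-! ### Partition diagrams -/

namespace PartitionDiagram

variable {A B C D A' B' C' : Type}

/-- The partition of `A ⊔ B ⊔ C` obtained by stacking the diagram `p` (with top row `A` and bottom
row `B`) on the diagram `q` (with top row `B` and bottom row `C`): the finest partition whose
restrictions to `A ⊔ B` and `B ⊔ C` are coarser than `p` and `q`. -/
def glue (p : Setoid (A ⊕ B)) (q : Setoid (B ⊕ C)) : Setoid (A ⊕ (B ⊕ C)) :=
  p.map (Sum.map id Sum.inl) ⊔ q.map Sum.inr

/-- The product diagram: stack `p` on `q` and restrict the partition to the outer rows. -/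
def comp (p : Setoid (A ⊕ B)) (q : Setoid (B ⊕ C)) : Setoid (A ⊕ C) :=
  (glue p q).comap (Sum.map id Sum.inr)

/-- The number of connected components, in the stacking of `p` on `q`, which lie entirely in the
middle row. -/
def loops (p : Setoid (A ⊕ B)) (q : Setoid (B ⊕ C)) : ℕ :=
  Nat.card {c : Quotient (glue p q) // ∀ u : A ⊕ C, Quotient.mk (glue p q) (Sum.map id Sum.inr u) ≠ c}

/-- Horizontal juxtaposition of diagrams. -/
def tensor (p : Setoid (A ⊕ B)) (q : Setoid (A' ⊕ B')) : Setoid ((A ⊕ A') ⊕ (B ⊕ B')) :=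
  p.map (Sum.map Sum.inl Sum.inl) ⊔ q.map (Sum.map Sum.inr Sum.inr)

/-- The diagram of a bijection `e`: its blocks are the sets `{a, e a}`. -/
def graph (e : A ≃ B) : Setoid (A ⊕ B) := Setoid.ker (Sum.elim e id)

/-- The diagram on `∅` and `A ⊔ A` whose blocks are the pairs of equal elements. -/
def cup (A : Type) : Setoid (Empty ⊕ (A ⊕ A)) :=
  Setoid.ker (Sum.elim Empty.elim (Sum.elim id id) : Empty ⊕ (A ⊕ A) → A)

/-- The diagram on `A ⊔ A` and `∅` whose blocks are the pairs of equal elements. -/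
def cap (A : Type) : Setoid ((A ⊕ A) ⊕ Empty) :=
  Setoid.ker (Sum.elim (Sum.elim id id) Empty.elim : (A ⊕ A) ⊕ Empty → A)

/-- A diagram is compatible with a labelling of its vertices if the labelling is constant on
blocks. -/
def Compat {X : Type} (p : Setoid (A ⊕ B)) (a : A → X) (b : B → X) : Prop :=
  p ≤ Setoid.ker (Sum.elim a b)

theorem map_le_iff {α β : Type} (r : Setoid α) (f : α → β) (s : Setoid β) :
    r.map f ≤ s ↔ r ≤ s.comap f := by
  constructor
  · intro h
    exact fun x y hxy => h (Relation.EqvGen.rel _ _ ⟨x, y, hxy, rfl, rfl⟩)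
  · intro h
    refine Setoid.eqvGen_le ?_
    rintro _ _ ⟨x, y, hxy, rfl, rfl⟩
    exact h hxy

theorem compat_tensor {X : Type} (p : Setoid (A ⊕ B)) (q : Setoid (A' ⊕ B')) (a : A ⊕ A' → X)
    (b : B ⊕ B' → X) : Compat (tensor p q) a b ↔
      Compat p (a ∘ Sum.inl) (b ∘ Sum.inl) ∧ Compat q (a ∘ Sum.inr) (b ∘ Sum.inr) := by
  have h1 : (Setoid.ker (Sum.elim a b)).comap (Sum.map Sum.inl Sum.inl) =
      Setoid.ker (Sum.elim (a ∘ Sum.inl) (b ∘ Sum.inl)) := by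
    ext x y; rcases x with x | x <;> rcases y with y | y <;> rfl
  have h2 : (Setoid.ker (Sum.elim a b)).comap (Sum.map Sum.inr Sum.inr) =
      Setoid.ker (Sum.elim (a ∘ Sum.inr) (b ∘ Sum.inr)) := by
    ext x y; rcases x with x | x <;> rcases y with y | y <;> rfl
  rw [Compat, tensor, sup_le_iff, map_le_iff, map_le_iff, h1, h2]; rfl

theorem glue_le_iff {X : Type} (p : Setoid (A ⊕ B)) (q : Setoid (B ⊕ C)) (a : A → X) (b : B → X)
    (c : C → X) : glue p q ≤ Setoid.ker (Sum.elim a (Sum.elim b c)) ↔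
      Compat p a b ∧ Compat q b c := by
  have h1 : (Setoid.ker (Sum.elim a (Sum.elim b c))).comap (Sum.map id Sum.inl) =
      Setoid.ker (Sum.elim a b) := by
    ext x y; rcases x with x | x <;> rcases y with y | y <;> rfl
  rw [glue, sup_le_iff, map_le_iff, map_le_iff, h1]; rfl

theorem compat_graph {X : Type} (e : A ≃ B) (a : A → X) (b : B → X) :
    Compat (graph e) a b ↔ a = b ∘ e := by
  constructor
  · intro h
    funext x
    exact @h (Sum.inl x) (Sum.inr (e x)) rfl
  · rintro rfl x y h
    have h' : Sum.elim e id x = Sum.elim e id y := h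
    have : ∀ z, Sum.elim (b ∘ e) b z = b (Sum.elim e id z) := by rintro (z | z) <;> rfl
    change Sum.elim (b ∘ e) b x = Sum.elim (b ∘ e) b y
    rw [this, this, h']

theorem compat_cup {X : Type} (a : Empty → X) (b : A ⊕ A → X) :
    Compat (cup A) a b ↔ b ∘ Sum.inl = b ∘ Sum.inr := by
  constructor
  · intro h
    funext x
    exact @h (Sum.inr (Sum.inl x)) (Sum.inr (Sum.inr x)) rfl
  · rintro hb (x | x | x) (y | y | y) h
    all_goals first
      | exact Empty.elim x
      | exact Empty.elim y
      | obtain rfl : x = y := h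
        first
          | rfl
          | exact congrFun hb x
          | exact (congrFun hb x).symm

theorem compat_cap {X : Type} (a : A ⊕ A → X) (b : Empty → X) :
    Compat (cap A) a b ↔ a ∘ Sum.inl = a ∘ Sum.inr := by
  constructor
  · intro h
    funext x
    exact @h (Sum.inl (Sum.inl x)) (Sum.inl (Sum.inr x)) rfl
  · rintro hb ((x | x) | x) ((y | y) | y) h
    all_goals first
      | exact Empty.elim x
      | exact Empty.elim y
      | obtain rfl : x = y := h
        first
          | rfl
          | exact congrFun hb x
          | exact (congrFun hb x).symm

section Semantics

open scoped Classical in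
/-- The indicator function of compatibility. -/
def ind {X : Type} (p : Setoid (A ⊕ B)) (a : A → X) (b : B → X) : ℕ := if Compat p a b then 1 else 0

/-- The labellings of the middle row compatible with both diagrams extend a fixed compatible
labelling of the outer rows by arbitrary labels on the components in the middle row. -/
theorem card_compat {X : Type} [Finite A] [Finite B] [Finite C] [Finite X]
    (p : Setoid (A ⊕ B)) (q : Setoid (B ⊕ C)) (a : A → X) (c : C → X) :
    Nat.card {b : B → X // Compat p a b ∧ Compat q b c} =
      Nat.card X ^ loops p q * ind (comp p q) a c := by
  classical
  let g := glue p q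
  let i : A ⊕ C → A ⊕ (B ⊕ C) := Sum.map id Sum.inr
  by_cases h : Compat (comp p q) a c
  · rw [ind, if_pos h, mul_one]
    -- extension data
    have hout : ∀ k : Quotient g, (¬ ∀ u, Quotient.mk g (i u) ≠ k) → ∃ u, Quotient.mk g (i u) = k := by
      intro k hk; push Not at hk; exact hk
    have hwd : ∀ u v, Quotient.mk g (i u) = Quotient.mk g (i v) →
        Sum.elim a c u = Sum.elim a c v := fun u v huv => h (show comp p q u v from Quotient.exact (s := g) huv)
    let ext (φ : {k : Quotient g // ∀ u, Quotient.mk g (i u) ≠ k} → X) (k : Quotient g) : X :=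
      if hk : ∀ u, Quotient.mk g (i u) ≠ k then φ ⟨k, hk⟩
      else Sum.elim a c (hout k hk).choose
    have ext_i : ∀ φ u, ext φ (Quotient.mk g (i u)) = Sum.elim a c u := by
      intro φ u
      have hk : ¬ ∀ v, Quotient.mk g (i v) ≠ Quotient.mk g (i u) := fun hh => hh u rfl
      simp only [ext, dif_neg hk]
      exact hwd _ _ (hout _ hk).choose_spec
    have elim_ext : ∀ φ, Sum.elim a (Sum.elim (fun b => ext φ (Quotient.mk g (Sum.inr (Sum.inl b)))) c) =
        fun z => ext φ (Quotient.mk g z) := by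
      intro φ; funext z
      rcases z with z | z | z
      · exact (ext_i φ (Sum.inl z)).symm
      · rfl
      · exact (ext_i φ (Sum.inr z)).symm
    have e : {b : B → X // Compat p a b ∧ Compat q b c} ≃
        ({k : Quotient g // ∀ u, Quotient.mk g (i u) ≠ k} → X) :=
      { toFun := fun b k => Quotient.lift (Sum.elim a (Sum.elim b.1 c))
          (fun x y hxy => (glue_le_iff p q a b.1 c).2 b.2 hxy) k.1
        invFun := fun φ => ⟨fun b => ext φ (Quotient.mk g (Sum.inr (Sum.inl b))), by
          rw [← glue_le_iff, elim_ext]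
          intro x y hxy
          exact congrArg (ext φ) (Quotient.sound hxy)⟩
        left_inv := by
          rintro ⟨b, hb⟩
          ext x
          have hle := (glue_le_iff p q a b c).2 hb
          simp only [ext]
          split_ifs with hk
          · rfl
          · have hs := (hout _ hk).choose_spec
            have h2 := hle (Quotient.exact hs)
            refine Eq.trans ?_ h2
            rcases (hout _ hk).choose with z | z <;> rfl
        right_inv := by
          intro φ
          funext ⟨k, hk⟩
          obtain ⟨z, rfl⟩ := Quotient.exists_rep k
          change Sum.elim a (Sum.elim _ c) z = _
          rw [elim_ext]
          simp only [ext]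
          rw [dif_pos hk] }
    rw [Nat.card_congr e, Nat.card_fun]
    rfl
  · rw [ind, if_neg h, mul_zero]
    have : IsEmpty {b : B → X // Compat p a b ∧ Compat q b c} := by
      constructor
      rintro ⟨b, hb⟩
      apply h
      have hle := (glue_le_iff p q a b c).2 hb
      intro x y hxy
      have := hle (show glue p q _ _ from hxy)
      rcases x with x | x <;> rcases y with y | y <;> exact this
    exact Nat.card_of_isEmpty

theorem sum_ind {X : Type} [Finite A] [Finite C] [Finite X] [Fintype (B → X)] [Finite B]
    (p : Setoid (A ⊕ B)) (q : Setoid (B ⊕ C)) (a : A → X) (c : C → X) :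
    ∑ b : B → X, ind p a b * ind q b c = Nat.card X ^ loops p q * ind (comp p q) a c := by
  classical
  rw [← card_compat, Nat.card_eq_fintype_card, Fintype.card_subtype, Finset.card_filter]
  refine Finset.sum_congr rfl fun b _ => ?_
  unfold ind
  split_ifs <;> simp_all

end Semantics

/-- A diagram together with a number of closed components. -/
abbrev Diag (A B : Type) := ℕ × Setoid (A ⊕ B)

namespace Diag

def sem (x : Diag A B) {X : Type} (a : A → X) (b : B → X) : ℕ := Nat.card X ^ x.1 * ind x.2 a b

theorem ext_sem [Finite A] [Finite B] {x y : Diag A B}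
    (h : ∀ (X : Type) [Finite X] (a : A → X) (b : B → X), x.sem a b = y.sem a b) : x = y := by
  obtain ⟨k, p⟩ := x
  obtain ⟨l, q⟩ := y
  have key : ∀ (k l : ℕ) (p q : Setoid (A ⊕ B)), (∀ (X : Type) [Finite X] (a : A → X) (b : B → X),
      sem (k, p) a b = sem (l, q) a b) → p ≤ q := by
    intro k l p q h
    let f : A ⊕ B → Option (Quotient q) := fun z => some (Quotient.mk q z)
    have hf : Sum.elim (f ∘ Sum.inl) (f ∘ Sum.inr) = f := by
      funext z; rcases z with z | z <;> rfl
    have h1 := h (Option (Quotient q)) (f ∘ Sum.inl) (f ∘ Sum.inr)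
    have hpos : 0 < Nat.card (Option (Quotient q)) := Nat.card_pos
    have hq : Compat q (f ∘ Sum.inl) (f ∘ Sum.inr) := by
      unfold Compat
      rw [hf]
      intro x y hxy
      exact congrArg some (Quotient.sound hxy)
    simp only [sem, ind, if_pos hq, mul_one] at h1
    have hp : Compat p (f ∘ Sum.inl) (f ∘ Sum.inr) := by
      by_contra hp
      rw [if_neg hp, mul_zero] at h1
      exact (pow_pos hpos l).ne h1
    unfold Compat at hp
    rw [hf] at hp
    intro x y hxy
    exact Quotient.exact (Option.some_injective _ (hp hxy))
  have hpq : p = q := le_antisymm (key _ _ _ _ h) (key _ _ _ _ fun X _ a b => (h X a b).symm)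
  subst hpq
  have h2 := h Bool (fun _ => true) (fun _ => true)
  have hc : Compat p (fun _ => true) (fun _ => true) := by
    intro x y _
    rcases x with x | x <;> rcases y with y | y <;> rfl
  simp only [sem, ind, if_pos hc, mul_one, Nat.card_eq_fintype_card, Fintype.card_bool] at h2
  rw [Nat.pow_right_injective le_rfl h2]

def comp (x : Diag A B) (y : Diag B C) : Diag A C :=
  (x.1 + y.1 + loops x.2 y.2, PartitionDiagram.comp x.2 y.2)

def tensor (x : Diag A B) (y : Diag A' B') : Diag (A ⊕ A') (B ⊕ B') :=
  (x.1 + y.1, PartitionDiagram.tensor x.2 y.2)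

def graph (e : A ≃ B) : Diag A B := (0, PartitionDiagram.graph e)

theorem sem_comp [Finite A] [Finite B] [Finite C] (x : Diag A B) (y : Diag B C) {X : Type} [Finite X]
    [Fintype (B → X)] (a : A → X) (c : C → X) :
    (x.comp y).sem a c = ∑ b : B → X, x.sem a b * y.sem b c := by
  simp only [sem, comp]
  rw [pow_add, mul_assoc, ← sum_ind, Finset.mul_sum]
  refine Finset.sum_congr rfl fun b _ => ?_
  rw [pow_add]; ring

theorem sem_tensor (x : Diag A B) (y : Diag A' B') {X : Type} (a : A ⊕ A' → X) (b : B ⊕ B' → X) :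
    (x.tensor y).sem a b =
      x.sem (a ∘ Sum.inl) (b ∘ Sum.inl) * y.sem (a ∘ Sum.inr) (b ∘ Sum.inr) := by
  classical
  simp only [sem, tensor, ind, compat_tensor, pow_add]
  split_ifs <;> simp_all

open scoped Classical in
theorem sem_graph (e : A ≃ B) {X : Type} (a : A → X) (b : B → X) :
    (graph e).sem a b = if a = b ∘ e then 1 else 0 := by
  simp [sem, graph, ind, compat_graph]

theorem sem_graph_comp [Finite A] [Finite B] [Finite C] (e : A ≃ B) (y : Diag B C) {X : Type}
    [Finite X] (a : A → X) (c : C → X) :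
    ((graph e).comp y).sem a c = y.sem (a ∘ e.symm) c := by
  classical
  have := Fintype.ofFinite (B → X)
  rw [sem_comp, Finset.sum_eq_single (a ∘ e.symm)]
  · rw [sem_graph, if_pos, one_mul]; funext x; simp
  · intro b _ hb
    rw [sem_graph, if_neg, zero_mul]
    rintro rfl; apply hb; funext x; simp
  · simp

theorem sem_comp_graph [Finite A] [Finite B] [Finite C] (x : Diag A B) (e : B ≃ C) {X : Type}
    [Finite X] (a : A → X) (c : C → X) :
    (x.comp (graph e)).sem a c = x.sem a (c ∘ e) := by
  classical
  have := Fintype.ofFinite (B → X)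
  rw [sem_comp, Finset.sum_eq_single (c ∘ e)]
  · rw [sem_graph, if_pos rfl, mul_one]
  · intro b _ hb
    rw [sem_graph, if_neg hb, mul_zero]
  · simp

theorem comp_assoc [Finite A] [Finite B] [Finite C] [Finite D] (x : Diag A B) (y : Diag B C)
    (z : Diag C D) : (x.comp y).comp z = x.comp (y.comp z) := by
  refine ext_sem fun X _ a d => ?_
  have := Fintype.ofFinite (B → X)
  have := Fintype.ofFinite (C → X)
  simp only [sem_comp, Finset.sum_mul, Finset.mul_sum]
  rw [Finset.sum_comm]
  simp only [mul_assoc]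

theorem graph_refl_comp [Finite A] [Finite B] (x : Diag A B) : (graph (Equiv.refl A)).comp x = x :=
  ext_sem fun X _ a b => by rw [sem_graph_comp]; rfl

theorem comp_graph_refl [Finite A] [Finite B] (x : Diag A B) : x.comp (graph (Equiv.refl B)) = x :=
  ext_sem fun X _ a b => by rw [sem_comp_graph]; rfl

theorem graph_comp_graph [Finite A] [Finite B] [Finite C] (e : A ≃ B) (f : B ≃ C) :
    (graph e).comp (graph f) = graph (e.trans f) :=
  ext_sem fun X _ a b => by
    rw [sem_comp_graph, sem_graph, sem_graph]; rfl

theorem graph_tensor_graph [Finite A] [Finite B] [Finite A'] [Finite B'] (e : A ≃ B) (f : A' ≃ B') :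
    (graph e).tensor (graph f) = graph (Equiv.sumCongr e f) :=
  ext_sem fun X _ a b => by
    classical
    rw [sem_tensor, sem_graph, sem_graph, sem_graph]
    have : a = b ∘ Equiv.sumCongr e f ↔ a ∘ Sum.inl = (b ∘ Sum.inl) ∘ e ∧
        a ∘ Sum.inr = (b ∘ Sum.inr) ∘ f := by
      constructor
      · rintro rfl; exact ⟨rfl, rfl⟩
      · rintro ⟨h1, h2⟩
        funext z
        rcases z with z | z
        · exact congrFun h1 z
        · exact congrFun h2 z
    rw [if_congr this rfl rfl]
    split_ifs <;> simp_all

theorem tensor_comp_tensor [Finite A] [Finite B] [Finite C] [Finite A'] [Finite B'] [Finite C']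
    (x : Diag A B) (x' : Diag A' B') (y : Diag B C) (y' : Diag B' C') :
    (x.tensor x').comp (y.tensor y') = (x.comp y).tensor (x'.comp y') := by
  refine ext_sem fun X _ a c => ?_
  have := Fintype.ofFinite (B → X)
  have := Fintype.ofFinite (B' → X)
  have := Fintype.ofFinite (B ⊕ B' → X)
  simp only [sem_comp, sem_tensor, Finset.sum_mul_sum]
  rw [← Finset.sum_product', Finset.univ_product_univ]
  refine Fintype.sum_equiv (Equiv.sumArrowEquivProdArrow B B' X) _ _ fun b => ?_
  exact mul_mul_mul_comm _ _ _ _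

theorem assoc_naturality [Finite A] [Finite B] [Finite C] [Finite A'] [Finite B'] [Finite C']
    (x : Diag A A') (y : Diag B B') (z : Diag C C') :
    ((x.tensor y).tensor z).comp (graph (Equiv.sumAssoc A' B' C')) =
      (graph (Equiv.sumAssoc A B C)).comp (x.tensor (y.tensor z)) := by
  refine ext_sem fun X _ a c => ?_
  rw [sem_comp_graph, sem_graph_comp]
  simp only [sem_tensor, mul_assoc]
  rfl

theorem leftUnitor_naturality [Finite A] [Finite B] (x : Diag A B) :
    ((graph (Equiv.refl Empty)).tensor x).comp (graph (Equiv.emptySum Empty B)) =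
      (graph (Equiv.emptySum Empty A)).comp x := by
  classical
  refine ext_sem fun X _ a c => ?_
  rw [sem_comp_graph, sem_graph_comp, sem_tensor, sem_graph, if_pos (Subsingleton.elim _ _), one_mul]
  rfl

theorem rightUnitor_naturality [Finite A] [Finite B] (x : Diag A B) :
    (x.tensor (graph (Equiv.refl Empty))).comp (graph (Equiv.sumEmpty B Empty)) =
      (graph (Equiv.sumEmpty A Empty)).comp x := by
  classical
  refine ext_sem fun X _ a c => ?_
  rw [sem_comp_graph, sem_graph_comp, sem_tensor, sem_graph, if_pos (Subsingleton.elim _ _), mul_one]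
  rfl

theorem braiding_naturality [Finite A] [Finite B] [Finite A'] [Finite B'] (x : Diag A B)
    (y : Diag A' B') : (x.tensor y).comp (graph (Equiv.sumComm B B')) =
      (graph (Equiv.sumComm A A')).comp (y.tensor x) := by
  refine ext_sem fun X _ a c => ?_
  rw [sem_comp_graph, sem_graph_comp, sem_tensor, sem_tensor, mul_comm]
  rfl

theorem zigzag_right [Finite A] :
    ((graph (Equiv.refl A)).tensor (0, cup A)).comp ((graph (Equiv.sumAssoc A A A).symm).comp
      (Diag.tensor (0, cap A) (graph (Equiv.refl A)))) =
        graph ((Equiv.sumEmpty A Empty).trans (Equiv.emptySum Empty A).symm) := by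
  classical
  refine ext_sem fun X _ a c => ?_
  have := Fintype.ofFinite (A ⊕ (A ⊕ A) → X)
  rw [sem_comp, sem_graph, Finset.sum_eq_single
    (Sum.elim (a ∘ Sum.inl) (Sum.elim (c ∘ Sum.inr) (c ∘ Sum.inr)))]
  · rw [sem_graph_comp, sem_tensor, sem_tensor, sem_graph, sem_graph]
    simp only [sem, ind, compat_cup, compat_cap, pow_zero, one_mul]
    have : (a = c ∘ ((Equiv.sumEmpty A Empty).trans (Equiv.emptySum Empty A).symm)) ↔
        a ∘ Sum.inl = c ∘ Sum.inr := by
      constructor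
      · rintro rfl; rfl
      · intro h; funext z
        rcases z with z | z
        · exact congrFun h z
        · exact z.elim
    rw [if_congr this rfl rfl]
    change (if a ∘ Sum.inl = a ∘ Sum.inl then 1 else 0) *
      (if c ∘ Sum.inr = c ∘ Sum.inr then 1 else 0) *
      ((if a ∘ Sum.inl = c ∘ Sum.inr then 1 else 0) *
      (if c ∘ Sum.inr = c ∘ Sum.inr then 1 else 0)) = _
    simp
  · intro b _ hb
    rw [sem_graph_comp, sem_tensor, sem_tensor, sem_graph, sem_graph]
    simp only [sem, ind, compat_cup, compat_cap, pow_zero, one_mul]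
    by_contra hne
    simp only [mul_eq_zero, not_or, ite_eq_right_iff, not_forall] at hne
    obtain ⟨⟨⟨h1, -⟩, ⟨h2, -⟩⟩, ⟨-, ⟨h4, -⟩⟩⟩ := hne
    apply hb
    funext z
    rcases z with z | z | z
    · exact (congrFun h1 z).symm
    · exact (congrFun h2 z).trans (congrFun h4 z)
    · exact congrFun h4 z
  · simp

theorem zigzag_left [Finite A] :
    (Diag.tensor (0, cup A) (graph (Equiv.refl A))).comp ((graph (Equiv.sumAssoc A A A)).comp
      ((graph (Equiv.refl A)).tensor (0, cap A))) =
        graph ((Equiv.emptySum Empty A).trans (Equiv.sumEmpty A Empty).symm) := by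
  classical
  refine ext_sem fun X _ a c => ?_
  have := Fintype.ofFinite ((A ⊕ A) ⊕ A → X)
  rw [sem_comp, sem_graph, Finset.sum_eq_single
    (Sum.elim (Sum.elim (c ∘ Sum.inl) (c ∘ Sum.inl)) (a ∘ Sum.inr))]
  · rw [sem_graph_comp, sem_tensor, sem_tensor, sem_graph, sem_graph]
    simp only [sem, ind, compat_cup, compat_cap, pow_zero, one_mul]
    have : (a = c ∘ ((Equiv.emptySum Empty A).trans (Equiv.sumEmpty A Empty).symm)) ↔
        c ∘ Sum.inl = a ∘ Sum.inr := by
      constructor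
      · rintro rfl; rfl
      · intro h; funext z
        rcases z with z | z
        · exact z.elim
        · exact (congrFun h z).symm
    rw [if_congr this rfl rfl]
    change (if c ∘ Sum.inl = c ∘ Sum.inl then 1 else 0) *
      (if a ∘ Sum.inr = a ∘ Sum.inr then 1 else 0) *
      ((if c ∘ Sum.inl = c ∘ Sum.inl then 1 else 0) *
      (if c ∘ Sum.inl = a ∘ Sum.inr then 1 else 0)) = _
    simp
  · intro b _ hb
    rw [sem_graph_comp, sem_tensor, sem_tensor, sem_graph, sem_graph]
    simp only [sem, ind, compat_cup, compat_cap, pow_zero, one_mul]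
    by_contra hne
    simp only [mul_eq_zero, not_or, ite_eq_right_iff, not_forall] at hne
    obtain ⟨⟨⟨h1, -⟩, ⟨h2, -⟩⟩, ⟨⟨h3, -⟩, ⟨h4, -⟩⟩⟩ := hne
    apply hb
    funext z
    rcases z with (z | z) | z
    · exact congrFun h3 z
    · exact (congrFun h1 z).symm.trans (congrFun h3 z)
    · exact (congrFun h2 z).symm
  · simp

end Diag

end PartitionDiagram

/-! ### Linear combinations of diagrams -/

namespace PartitionDiagram

variable {F : Type u} [Field F] {A B C D A' B' C' : Type}

/-- The bilinear extension of a function on pairs of basis elements. -/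
def bilin {ι κ M : Type*} [AddCommGroup M] [Module F M] (φ : ι → κ → M) :
    (ι →₀ F) →ₗ[F] (κ →₀ F) →ₗ[F] M :=
  Finsupp.linearCombination F fun i => Finsupp.linearCombination F (φ i)

theorem bilin_single {ι κ M : Type*} [AddCommGroup M] [Module F M] (φ : ι → κ → M) (i : ι) (j : κ)
    (a b : F) : bilin φ (Finsupp.single i a) (Finsupp.single j b) = (a * b) • φ i j := by
  simp [bilin, Finsupp.linearCombination_single, mul_smul]

variable (F) in
/-- Formal linear combinations of partition diagrams with top row `A` and bottom row `B`. -/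
abbrev Lin (A B : Type) : Type u := Setoid (A ⊕ B) →₀ F

/-- Composition of linear combinations of diagrams: the composite of the diagrams `p` and `q` is
`t ^ ℓ` times the product diagram, where `ℓ` is the number of components lost in the middle row. -/
def compLin (t : F) : Lin F A B →ₗ[F] Lin F B C →ₗ[F] Lin F A C :=
  bilin fun p q => t ^ loops p q • Finsupp.single (comp p q) 1

/-- Juxtaposition of diagrams, extended bilinearly. -/
def tensLin : Lin F A B →ₗ[F] Lin F A' B' →ₗ[F] Lin F (A ⊕ A') (B ⊕ B') :=
  bilin fun p q => Finsupp.single (tensor p q) 1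

/-- A diagram with closed components as a linear combination: each closed component is worth
`t`. -/
def diagLin (t : F) (x : Diag A B) : Lin F A B := Finsupp.single x.2 (t ^ x.1)

variable (F) in
/-- The diagram of a bijection. -/
def graphLin (e : A ≃ B) : Lin F A B := Finsupp.single (graph e) 1

theorem graphLin_eq (t : F) (e : A ≃ B) : graphLin F e = diagLin t (Diag.graph e) := by
  simp [graphLin, diagLin, Diag.graph]

theorem single_eq (t : F) (p : Setoid (A ⊕ B)) : Finsupp.single p 1 = diagLin t (0, p) := by
  simp [diagLin]

theorem compLin_diagLin (t : F) (x : Diag A B) (y : Diag B C) :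
    compLin t (diagLin t x) (diagLin t y) = diagLin t (x.comp y) := by
  unfold compLin diagLin
  rw [bilin_single]
  simp [Diag.comp, pow_add]

theorem tensLin_diagLin (t : F) (x : Diag A B) (y : Diag A' B') :
    tensLin (diagLin t x) (diagLin t y) = diagLin t (x.tensor y) := by
  unfold tensLin diagLin
  rw [bilin_single]
  simp [Diag.tensor, pow_add]

theorem lin_induction (t : F) {P : Lin F A B → Prop} (f : Lin F A B) (h0 : P 0)
    (hadd : ∀ f g, P f → P g → P (f + g)) (hsmul : ∀ (a : F) f, P f → P (a • f))
    (hd : ∀ x : Diag A B, P (diagLin t x)) : P f := by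
  refine Finsupp.induction_linear f h0 (fun f g => hadd f g) fun p a => ?_
  have := hsmul a _ (hd (0, p))
  simpa [diagLin] using this

theorem compLin_assoc [Finite A] [Finite B] [Finite C] [Finite D] (t : F) (f : Lin F A B)
    (g : Lin F B C) (h : Lin F C D) :
    compLin t (compLin t f g) h = compLin t f (compLin t g h) := by
  induction f using lin_induction t with
  | h0 => simp
  | hadd f f' h1 h2 => simp [h1, h2]
  | hsmul a f h1 => simp [h1]
  | hd x =>
  induction g using lin_induction t with
  | h0 => simp
  | hadd f f' h1 h2 => simp [h1, h2]
  | hsmul a f h1 => simp [h1]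
  | hd y =>
  induction h using lin_induction t with
  | h0 => simp
  | hadd f f' h1 h2 => simp [h1, h2]
  | hsmul a f h1 => simp [h1]
  | hd z => simp [compLin_diagLin, Diag.comp_assoc]

theorem graphLin_refl_comp [Finite A] [Finite B] (t : F) (f : Lin F A B) :
    compLin t (graphLin F (Equiv.refl A)) f = f := by
  induction f using lin_induction t with
  | h0 => simp
  | hadd f f' h1 h2 => simp [h1, h2]
  | hsmul a f h1 => simp [h1]
  | hd x => simp [compLin_diagLin, graphLin_eq t, Diag.graph_refl_comp]

theorem comp_graphLin_refl [Finite A] [Finite B] (t : F) (f : Lin F A B) :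
    compLin t f (graphLin F (Equiv.refl B)) = f := by
  induction f using lin_induction t with
  | h0 => simp
  | hadd f f' h1 h2 => simp [h1, h2]
  | hsmul a f h1 => simp [h1]
  | hd x => simp [compLin_diagLin, graphLin_eq t, Diag.comp_graph_refl]

theorem graphLin_comp [Finite A] [Finite B] [Finite C] (t : F) (e : A ≃ B) (f : B ≃ C) :
    compLin t (graphLin F e) (graphLin F f) = graphLin F (e.trans f) := by
  simp only [graphLin_eq t, compLin_diagLin, Diag.graph_comp_graph]

theorem graphLin_tensor [Finite A] [Finite B] [Finite A'] [Finite B'] (e : A ≃ B) (f : A' ≃ B') :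
    tensLin (graphLin F e) (graphLin F f) = graphLin F (Equiv.sumCongr e f) := by
  simp only [graphLin_eq (0 : F), tensLin_diagLin, Diag.graph_tensor_graph]

theorem tensLin_comp_tensLin [Finite A] [Finite B] [Finite C] [Finite A'] [Finite B'] [Finite C']
    (t : F) (f : Lin F A B) (f' : Lin F A' B') (g : Lin F B C) (g' : Lin F B' C') :
    compLin t (tensLin f f') (tensLin g g') = tensLin (compLin t f g) (compLin t f' g') := by
  induction f using lin_induction t with
  | h0 => simp
  | hadd f f' h1 h2 => simp [h1, h2]
  | hsmul a f h1 => simp [h1]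
  | hd x =>
  induction f' using lin_induction t with
  | h0 => simp
  | hadd f f' h1 h2 => simp [h1, h2]
  | hsmul a f h1 => simp [h1]
  | hd y =>
  induction g using lin_induction t with
  | h0 => simp
  | hadd f f' h1 h2 => simp [h1, h2]
  | hsmul a f h1 => simp [h1]
  | hd z =>
  induction g' using lin_induction t with
  | h0 => simp
  | hadd f f' h1 h2 => simp [h1, h2]
  | hsmul a f h1 => simp [h1]
  | hd w => simp only [tensLin_diagLin, compLin_diagLin, Diag.tensor_comp_tensor]

theorem assoc_naturality [Finite A] [Finite B] [Finite C] [Finite A'] [Finite B'] [Finite C']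
    (t : F) (f : Lin F A A') (g : Lin F B B') (h : Lin F C C') :
    compLin t (tensLin (tensLin f g) h) (graphLin F (Equiv.sumAssoc A' B' C')) =
      compLin t (graphLin F (Equiv.sumAssoc A B C)) (tensLin f (tensLin g h)) := by
  induction f using lin_induction t with
  | h0 => simp
  | hadd f f' h1 h2 => simp [h1, h2]
  | hsmul a f h1 => simp [h1]
  | hd x =>
  induction g using lin_induction t with
  | h0 => simp
  | hadd f f' h1 h2 => simp [h1, h2]
  | hsmul a f h1 => simp [h1]
  | hd y =>
  induction h using lin_induction t with
  | h0 => simp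
  | hadd f f' h1 h2 => simp [h1, h2]
  | hsmul a f h1 => simp [h1]
  | hd z => simp only [tensLin_diagLin, graphLin_eq t, compLin_diagLin, Diag.assoc_naturality]

theorem leftUnitor_naturality [Finite A] [Finite B] (t : F) (f : Lin F A B) :
    compLin t (tensLin (graphLin F (Equiv.refl Empty)) f) (graphLin F (Equiv.emptySum Empty B)) =
      compLin t (graphLin F (Equiv.emptySum Empty A)) f := by
  induction f using lin_induction t with
  | h0 => simp
  | hadd f f' h1 h2 => simp [h1, h2]
  | hsmul a f h1 => simp [h1]
  | hd x => simp only [tensLin_diagLin, graphLin_eq t, compLin_diagLin, Diag.leftUnitor_naturality]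

theorem rightUnitor_naturality [Finite A] [Finite B] (t : F) (f : Lin F A B) :
    compLin t (tensLin f (graphLin F (Equiv.refl Empty))) (graphLin F (Equiv.sumEmpty B Empty)) =
      compLin t (graphLin F (Equiv.sumEmpty A Empty)) f := by
  induction f using lin_induction t with
  | h0 => simp
  | hadd f f' h1 h2 => simp [h1, h2]
  | hsmul a f h1 => simp [h1]
  | hd x => simp only [tensLin_diagLin, graphLin_eq t, compLin_diagLin, Diag.rightUnitor_naturality]

theorem braiding_naturality [Finite A] [Finite B] [Finite A'] [Finite B'] (t : F) (f : Lin F A B)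
    (g : Lin F A' B') :
    compLin t (tensLin f g) (graphLin F (Equiv.sumComm B B')) =
      compLin t (graphLin F (Equiv.sumComm A A')) (tensLin g f) := by
  induction f using lin_induction t with
  | h0 => simp
  | hadd f f' h1 h2 => simp [h1, h2]
  | hsmul a f h1 => simp [h1]
  | hd x =>
  induction g using lin_induction t with
  | h0 => simp
  | hadd f f' h1 h2 => simp [h1, h2]
  | hsmul a f h1 => simp [h1]
  | hd y => simp only [tensLin_diagLin, graphLin_eq t, compLin_diagLin, Diag.braiding_naturality]

theorem pentagon [Finite A] [Finite B] [Finite C] [Finite D] (t : F) :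
    compLin t (tensLin (graphLin F (Equiv.sumAssoc A B C)) (graphLin F (Equiv.refl D)))
      (compLin t (graphLin F (Equiv.sumAssoc A (B ⊕ C) D))
        (tensLin (graphLin F (Equiv.refl A)) (graphLin F (Equiv.sumAssoc B C D)))) =
    compLin t (graphLin F (Equiv.sumAssoc (A ⊕ B) C D))
      (graphLin F (Equiv.sumAssoc A B (C ⊕ D))) := by
  simp only [graphLin_tensor, graphLin_comp]
  congr 1
  ext (((z | z) | z) | z) <;> rfl

theorem triangle [Finite A] [Finite B] (t : F) :
    compLin t (graphLin F (Equiv.sumAssoc A Empty B))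
      (tensLin (graphLin F (Equiv.refl A)) (graphLin F (Equiv.emptySum Empty B))) =
    tensLin (graphLin F (Equiv.sumEmpty A Empty)) (graphLin F (Equiv.refl B)) := by
  simp only [graphLin_tensor, graphLin_comp]
  congr 1
  ext ((z | z) | z)
  · rfl
  · exact Empty.elim z
  · rfl

theorem hexagon_forward [Finite A] [Finite B] [Finite C] (t : F) :
    compLin t (graphLin F (Equiv.sumAssoc A B C)) (compLin t (graphLin F (Equiv.sumComm A (B ⊕ C)))
      (graphLin F (Equiv.sumAssoc B C A))) =
    compLin t (tensLin (graphLin F (Equiv.sumComm A B)) (graphLin F (Equiv.refl C)))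
      (compLin t (graphLin F (Equiv.sumAssoc B A C))
        (tensLin (graphLin F (Equiv.refl B)) (graphLin F (Equiv.sumComm A C)))) := by
  simp only [graphLin_tensor, graphLin_comp]
  congr 1
  ext ((z | z) | z) <;> rfl

theorem hexagon_reverse [Finite A] [Finite B] [Finite C] (t : F) :
    compLin t (graphLin F (Equiv.sumAssoc A B C).symm)
      (compLin t (graphLin F (Equiv.sumComm (A ⊕ B) C)) (graphLin F (Equiv.sumAssoc C A B).symm)) =
    compLin t (tensLin (graphLin F (Equiv.refl A)) (graphLin F (Equiv.sumComm B C)))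
      (compLin t (graphLin F (Equiv.sumAssoc A C B).symm)
        (tensLin (graphLin F (Equiv.sumComm A C)) (graphLin F (Equiv.refl B)))) := by
  simp only [graphLin_tensor, graphLin_comp]
  congr 1
  ext (z | z | z) <;> rfl

theorem zigzag_right [Finite A] (t : F) :
    compLin t (tensLin (graphLin F (Equiv.refl A)) (Finsupp.single (cup A) 1))
      (compLin t (graphLin F (Equiv.sumAssoc A A A).symm)
        (tensLin (Finsupp.single (cap A) 1) (graphLin F (Equiv.refl A)))) =
    compLin t (graphLin F (Equiv.sumEmpty A Empty)) (graphLin F (Equiv.emptySum Empty A).symm) := by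
  rw [graphLin_comp]
  simp only [graphLin_eq t, single_eq t, tensLin_diagLin, compLin_diagLin, Diag.zigzag_right]

theorem zigzag_left [Finite A] (t : F) :
    compLin t (tensLin (Finsupp.single (cup A) 1) (graphLin F (Equiv.refl A)))
      (compLin t (graphLin F (Equiv.sumAssoc A A A))
        (tensLin (graphLin F (Equiv.refl A)) (Finsupp.single (cap A) 1))) =
    compLin t (graphLin F (Equiv.emptySum Empty A)) (graphLin F (Equiv.sumEmpty A Empty).symm) := by
  rw [graphLin_comp]
  simp only [graphLin_eq t, single_eq t, tensLin_diagLin, compLin_diagLin, Diag.zigzag_left]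

end PartitionDiagram

/-! ### The category with one object for each finite set -/

/-- An object `[A]` of the category `Rep₀(S_t; F)`: a finite set `A`. -/
structure RepZero (F : Type u) (t : F) where
  of ::
  /-- the underlying finite set -/
  carrier : Type
  [finite : Finite carrier]

attribute [instance] RepZero.finite

namespace RepZero

open PartitionDiagram

variable {F : Type u} [Field F] {t : F}

/-- The morphisms `[A] ⟶ [B]` are the formal `F`-linear combinations of partition diagrams. -/
instance : Category.{u} (RepZero F t) where
  Hom X Y := Lin F X.carrier Y.carrier
  id X := graphLin F (Equiv.refl X.carrier)
  comp f g := compLin t f g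
  id_comp f := graphLin_refl_comp t f
  comp_id f := comp_graphLin_refl t f
  assoc f g h := compLin_assoc t f g h

instance : Preadditive (RepZero F t) where
  homGroup X Y := inferInstanceAs (AddCommGroup (Lin F X.carrier Y.carrier))
  add_comp _ _ _ f f' g := LinearMap.map_add₂ (compLin t) f f' g
  comp_add _ Y Z f g g' := (compLin (B := Y.carrier) (C := Z.carrier) t f).map_add g g'

instance : Linear F (RepZero F t) where
  homModule X Y := inferInstanceAs (Module F (Lin F X.carrier Y.carrier))
  smul_comp _ _ _ r f g := LinearMap.map_smul₂ (compLin t) r f g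
  comp_smul _ Y Z f r g := (compLin (B := Y.carrier) (C := Z.carrier) t f).map_smul r g

/-- A partition diagram as a morphism. -/
def diagram (X Y : RepZero F t) (p : Setoid (X.carrier ⊕ Y.carrier)) : X ⟶ Y :=
  (Finsupp.single p 1 : Lin F X.carrier Y.carrier)

/-- The coefficient of a partition diagram in a morphism. -/
def coeff {X Y : RepZero F t} (f : X ⟶ Y) (p : Setoid (X.carrier ⊕ Y.carrier)) : F :=
  (show Lin F X.carrier Y.carrier from f) p

/-- The isomorphism given by a bijection. -/
def equivIso (X Y : RepZero F t) (e : X.carrier ≃ Y.carrier) : X ≅ Y where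
  hom := diagram X Y (graph e)
  inv := diagram Y X (graph e.symm)
  hom_inv_id := (graphLin_comp t e e.symm).trans (by rw [Equiv.self_trans_symm]; rfl)
  inv_hom_id := (graphLin_comp t e.symm e).trans (by rw [Equiv.symm_trans_self]; rfl)

/-- The tensor product is the disjoint union of finite sets and the juxtaposition of diagrams. -/
instance : MonoidalCategoryStruct (RepZero F t) where
  tensorObj X Y := ⟨X.carrier ⊕ Y.carrier⟩
  tensorUnit := ⟨Empty⟩
  tensorHom {X₁ Y₁ X₂ Y₂} f g :=
    tensLin (show Lin F X₁.carrier Y₁.carrier from f) (show Lin F X₂.carrier Y₂.carrier from g)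
  whiskerLeft X {Y₁ Y₂} f :=
    tensLin (graphLin F (Equiv.refl X.carrier)) (show Lin F Y₁.carrier Y₂.carrier from f)
  whiskerRight {X₁ X₂} f Y :=
    tensLin (show Lin F X₁.carrier X₂.carrier from f) (graphLin F (Equiv.refl Y.carrier))
  associator X Y Z := equivIso ⟨(X.carrier ⊕ Y.carrier) ⊕ Z.carrier⟩
    ⟨X.carrier ⊕ (Y.carrier ⊕ Z.carrier)⟩ (Equiv.sumAssoc X.carrier Y.carrier Z.carrier)
  leftUnitor X := equivIso ⟨Empty ⊕ X.carrier⟩ X (Equiv.emptySum Empty X.carrier)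
  rightUnitor X := equivIso ⟨X.carrier ⊕ Empty⟩ X (Equiv.sumEmpty X.carrier Empty)

instance : MonoidalCategory (RepZero F t) :=
  MonoidalCategory.ofTensorHom
    (fun X Y => (graphLin_tensor (F := F) (Equiv.refl X.carrier) (Equiv.refl Y.carrier)).trans
      (by rw [Equiv.sumCongr_refl]; rfl))
    (fun _ _ _ _ => rfl)
    (fun _ _ => rfl)
    (fun f₁ f₂ g₁ g₂ => tensLin_comp_tensLin t f₁ f₂ g₁ g₂)
    (fun f₁ f₂ f₃ => assoc_naturality t f₁ f₂ f₃)
    (fun f => leftUnitor_naturality t f)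
    (fun f => rightUnitor_naturality t f)
    (fun W X Y Z => pentagon (A := W.carrier) (B := X.carrier) (C := Y.carrier) (D := Z.carrier) t)
    (fun X Y => triangle (A := X.carrier) (B := Y.carrier) t)

instance : MonoidalPreadditive (RepZero F t) where
  whiskerLeft_zero {X _ _} := map_zero (tensLin (graphLin F (Equiv.refl X.carrier)))
  zero_whiskerRight {X _ _} := LinearMap.map_zero₂ tensLin (graphLin F (Equiv.refl X.carrier))
  whiskerLeft_add {X _ _} f g := map_add (tensLin (graphLin F (Equiv.refl X.carrier))) f g
  add_whiskerRight {X _ _} f g :=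
    LinearMap.map_add₂ tensLin f g (graphLin F (Equiv.refl X.carrier))

instance : MonoidalLinear F (RepZero F t) where
  whiskerLeft_smul X _ _ r f := map_smul (tensLin (graphLin F (Equiv.refl X.carrier))) r f
  smul_whiskerRight r _ _ f X :=
    LinearMap.map_smul₂ tensLin r f (graphLin F (Equiv.refl X.carrier))

instance : SymmetricCategory (RepZero F t) where
  braiding X Y := equivIso ⟨X.carrier ⊕ Y.carrier⟩ ⟨Y.carrier ⊕ X.carrier⟩
    (Equiv.sumComm X.carrier Y.carrier)
  braiding_naturality_right X _ _ f := braiding_naturality t (graphLin F (Equiv.refl X.carrier)) f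
  braiding_naturality_left f Z := braiding_naturality t f (graphLin F (Equiv.refl Z.carrier))
  hexagon_forward X Y Z :=
    PartitionDiagram.hexagon_forward (A := X.carrier) (B := Y.carrier) (C := Z.carrier) t
  hexagon_reverse X Y Z :=
    PartitionDiagram.hexagon_reverse (A := X.carrier) (B := Y.carrier) (C := Z.carrier) t
  symmetry X Y := (graphLin_comp t (Equiv.sumComm X.carrier Y.carrier) _).trans (by
    rw [show (Equiv.sumComm X.carrier Y.carrier).trans (Equiv.sumComm Y.carrier X.carrier) =
      Equiv.refl _ by ext (z | z) <;> rfl]; rfl)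

/-- Every object `[A]` is its own dual. -/
instance exactPairing (X : RepZero F t) : ExactPairing X X where
  coevaluation' := diagram ⟨Empty⟩ ⟨X.carrier ⊕ X.carrier⟩ (cup X.carrier)
  evaluation' := diagram ⟨X.carrier ⊕ X.carrier⟩ ⟨Empty⟩ (cap X.carrier)
  coevaluation_evaluation' := zigzag_right (A := X.carrier) t
  evaluation_coevaluation' := zigzag_left (A := X.carrier) t

instance : RightRigidCategory (RepZero F t) where
  rightDual X := { rightDual := X }

end RepZero

/-! ### Tensor products in the additive envelope -/

namespace AdditiveEnvelope

set_option linter.unusedSectionVars false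

section Matrices

variable {C : Type u} [Category.{v} C] [Preadditive C]
variable {ι κ μ ν ι' κ' μ' : Type}

/-- Matrices of morphisms between two tuples of objects. -/
abbrev Mtx (X : ι → C) (Y : κ → C) := ∀ i j, X i ⟶ Y j

/-- Multiplication of matrices. -/
def mul [Fintype κ] {X : ι → C} {Y : κ → C} {Z : μ → C} (f : Mtx X Y) (g : Mtx Y Z) : Mtx X Z :=
  fun i k => ∑ j, f i j ≫ g j k

open scoped Classical in
/-- The identity matrix. -/
def one (X : ι → C) : Mtx X X := fun i j => if h : i = j then eqToHom (congrArg X h) else 0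

open scoped Classical in
/-- The matrix with a single nonzero entry `φ i : X i ⟶ Y (σ i)` in the row of index `i`. -/
def reindex {X : ι → C} {Y : κ → C} (σ : ι → κ) (φ : ∀ i, X i ⟶ Y (σ i)) : Mtx X Y :=
  fun i j => if h : σ i = j then φ i ≫ eqToHom (congrArg Y h) else 0

theorem one_self (X : ι → C) (i : ι) : one X i i = 𝟙 (X i) := by simp [one]

theorem one_of_ne (X : ι → C) {i j : ι} (h : i ≠ j) : one X i j = 0 := by simp [one, h]

theorem reindex_self {X : ι → C} {Y : κ → C} (σ : ι → κ) (φ : ∀ i, X i ⟶ Y (σ i)) (i : ι) :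
    reindex σ φ i (σ i) = φ i := by
  simp [reindex]

theorem reindex_of_ne {X : ι → C} {Y : κ → C} (σ : ι → κ) (φ : ∀ i, X i ⟶ Y (σ i)) {i : ι} {j : κ}
    (h : σ i ≠ j) : reindex σ φ i j = 0 := by
  simp [reindex, h]

theorem reindex_mul [Fintype κ] {X : ι → C} {Y : κ → C} {Z : μ → C} (σ : ι → κ)
    (φ : ∀ i, X i ⟶ Y (σ i)) (f : Mtx Y Z) (i : ι) (k : μ) :
    mul (reindex σ φ) f i k = φ i ≫ f (σ i) k := by
  rw [mul, Finset.sum_eq_single (σ i)]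
  · rw [reindex_self]
  · intro j _ hj
    rw [reindex_of_ne _ _ hj.symm, Limits.zero_comp]
  · simp

theorem mul_reindex [Fintype κ] {X : ι → C} {Y : κ → C} {Z : μ → C} (σ : κ → μ)
    (hσ : Function.Injective σ) (φ : ∀ i, Y i ⟶ Z (σ i)) (f : Mtx X Y) (i : ι) (j : κ) :
    mul f (reindex σ φ) i (σ j) = f i j ≫ φ j := by
  rw [mul, Finset.sum_eq_single j]
  · rw [reindex_self]
  · intro k _ hk
    rw [reindex_of_ne _ _ (fun h => hk (hσ h)), Limits.comp_zero]
  · simp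

theorem mtx_ext {X : ι → C} {Y : κ → C} (σ : μ → κ) (hσ : Function.Surjective σ) {f g : Mtx X Y}
    (h : ∀ i j, f i (σ j) = g i (σ j)) : f = g := by
  funext i j
  obtain ⟨j, rfl⟩ := hσ j
  exact h i j

theorem one_eq_reindex (X : ι → C) : one X = reindex id (fun i => 𝟙 (X i)) := by
  funext i j
  simp [one, reindex]

theorem reindex_mul_reindex [Fintype κ] {X : ι → C} {Y : κ → C} {Z : μ → C} (σ : ι → κ)
    (φ : ∀ i, X i ⟶ Y (σ i)) (τ : κ → μ) (ψ : ∀ i, Y i ⟶ Z (τ i)) :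
    mul (reindex σ φ) (reindex τ ψ) = reindex (fun i => τ (σ i)) (fun i => φ i ≫ ψ (σ i)) := by
  funext i k
  rw [reindex_mul]
  by_cases h : τ (σ i) = k
  · subst h
    rw [reindex_self]
    exact (reindex_self (fun i => τ (σ i)) (fun i => φ i ≫ ψ (σ i)) i).symm
  · rw [reindex_of_ne _ _ h, Limits.comp_zero]
    exact (reindex_of_ne (fun i => τ (σ i)) (fun i => φ i ≫ ψ (σ i)) h).symm

variable [MonoidalCategory C]

/-- The tensor product of two tuples of objects. -/
abbrev tensFam (X : ι → C) (Y : κ → C) : ι × κ → C := fun i => X i.1 ⊗ Y i.2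

variable (C) in
/-- The tuple consisting of the unit object. -/
abbrev unitFam : PUnit.{1} → C := fun _ => 𝟙_ C

/-- The tensor product of matrices of morphisms is the Kronecker product. -/
def tens {X : ι → C} {Y : κ → C} {X' : ι' → C} {Y' : κ' → C} (f : Mtx X Y) (g : Mtx X' Y') :
    Mtx (tensFam X X') (tensFam Y Y') :=
  fun i j => f i.1 j.1 ⊗ₘ g i.2 j.2

/-- The associativity constraint. -/
def assocHom (X : ι → C) (Y : κ → C) (Z : μ → C) :
    Mtx (tensFam (tensFam X Y) Z) (tensFam X (tensFam Y Z)) :=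
  reindex (fun i => (i.1.1, (i.1.2, i.2))) (fun i => (α_ (X i.1.1) (Y i.1.2) (Z i.2)).hom)

/-- The inverse of the associativity constraint. -/
def assocInv (X : ι → C) (Y : κ → C) (Z : μ → C) :
    Mtx (tensFam X (tensFam Y Z)) (tensFam (tensFam X Y) Z) :=
  reindex (fun i => ((i.1, i.2.1), i.2.2)) (fun i => (α_ (X i.1) (Y i.2.1) (Z i.2.2)).inv)

/-- The left unit constraint. -/
def leftHom (X : ι → C) : Mtx (tensFam (unitFam C) X) X :=
  reindex (fun i => i.2) (fun i => (λ_ (X i.2)).hom)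

/-- The inverse of the left unit constraint. -/
def leftInv (X : ι → C) : Mtx X (tensFam (unitFam C) X) :=
  reindex (fun i => (PUnit.unit, i)) (fun i => (λ_ (X i)).inv)

/-- The right unit constraint. -/
def rightHom (X : ι → C) : Mtx (tensFam X (unitFam C)) X :=
  reindex (fun i => i.1) (fun i => (ρ_ (X i.1)).hom)

/-- The inverse of the right unit constraint. -/
def rightInv (X : ι → C) : Mtx X (tensFam X (unitFam C)) :=
  reindex (fun i => (i, PUnit.unit)) (fun i => (ρ_ (X i)).inv)

/-- The braiding. -/
def braidHom [BraidedCategory C] (X : ι → C) (Y : κ → C) : Mtx (tensFam X Y) (tensFam Y X) :=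
  reindex (fun i => (i.2, i.1)) (fun i => (β_ (X i.1) (Y i.2)).hom)

/-- The inverse of the braiding. -/
def braidInv [BraidedCategory C] (X : ι → C) (Y : κ → C) : Mtx (tensFam Y X) (tensFam X Y) :=
  reindex (fun i => (i.2, i.1)) (fun i => (β_ (X i.2) (Y i.1)).inv)

section

variable [Fintype ι] [Fintype κ] [Fintype μ]

theorem assocHom_inv (X : ι → C) (Y : κ → C) (Z : μ → C) :
    mul (assocHom X Y Z) (assocInv X Y Z) = one _ := by
  rw [assocHom, assocInv, reindex_mul_reindex, one_eq_reindex]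
  congr 1
  funext i
  exact Iso.hom_inv_id _

theorem assocInv_hom (X : ι → C) (Y : κ → C) (Z : μ → C) :
    mul (assocInv X Y Z) (assocHom X Y Z) = one _ := by
  rw [assocHom, assocInv, reindex_mul_reindex, one_eq_reindex]
  congr 1
  funext i
  exact Iso.inv_hom_id _

theorem leftHom_inv (X : ι → C) : mul (leftHom X) (leftInv X) = one _ := by
  rw [leftHom, leftInv, reindex_mul_reindex, one_eq_reindex]
  congr 1
  funext i
  exact Iso.hom_inv_id _

theorem leftInv_hom (X : ι → C) : mul (leftInv X) (leftHom X) = one _ := by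
  rw [leftHom, leftInv, reindex_mul_reindex, one_eq_reindex]
  congr 1
  funext i
  exact Iso.inv_hom_id _

theorem rightHom_inv (X : ι → C) : mul (rightHom X) (rightInv X) = one _ := by
  rw [rightHom, rightInv, reindex_mul_reindex, one_eq_reindex]
  congr 1
  funext i
  exact Iso.hom_inv_id _

theorem rightInv_hom (X : ι → C) : mul (rightInv X) (rightHom X) = one _ := by
  rw [rightHom, rightInv, reindex_mul_reindex, one_eq_reindex]
  congr 1
  funext i
  exact Iso.inv_hom_id _

theorem braidHom_inv [BraidedCategory C] (X : ι → C) (Y : κ → C) :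
    mul (braidHom X Y) (braidInv X Y) = one _ := by
  rw [braidHom, braidInv, reindex_mul_reindex, one_eq_reindex]
  congr 1
  funext i
  exact Iso.hom_inv_id _

theorem braidInv_hom [BraidedCategory C] (X : ι → C) (Y : κ → C) :
    mul (braidInv X Y) (braidHom X Y) = one _ := by
  rw [braidHom, braidInv, reindex_mul_reindex, one_eq_reindex]
  congr 1
  funext i
  exact Iso.inv_hom_id _

end

theorem braid_naturality [BraidedCategory C] [Fintype κ] [Fintype κ'] [Fintype ι] [Fintype ι']
    {X : ι → C} {Y : κ → C} {X' : ι' → C} {Y' : κ' → C} (f : Mtx X Y) (g : Mtx X' Y') :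
    mul (tens f g) (braidHom Y Y') = mul (braidHom X X') (tens g f) := by
  refine mtx_ext (fun i : κ × κ' => (i.2, i.1)) (Prod.swap_surjective) fun i j => ?_
  rw [braidHom, braidHom, reindex_mul]
  refine (mul_reindex (fun i : κ × κ' => (i.2, i.1)) (Prod.swap_injective) _ _ i j).trans ?_
  exact BraidedCategory.braiding_naturality _ _

theorem assoc_naturality [Fintype ι] [Fintype κ] [Fintype μ] [Fintype ι'] [Fintype κ'] [Fintype μ']
    {X : ι → C} {Y : κ → C} {Z : μ → C} {X' : ι' → C} {Y' : κ' → C} {Z' : μ' → C}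
    (f : Mtx X X') (g : Mtx Y Y') (h : Mtx Z Z') :
    mul (tens (tens f g) h) (assocHom X' Y' Z') = mul (assocHom X Y Z) (tens f (tens g h)) := by
  refine mtx_ext (fun i : (ι' × κ') × μ' => (i.1.1, (i.1.2, i.2))) ((Equiv.prodAssoc ι' κ' μ').surjective) fun i j => ?_
  rw [assocHom, assocHom, reindex_mul]
  refine (mul_reindex (fun i : (ι' × κ') × μ' => (i.1.1, (i.1.2, i.2))) ((Equiv.prodAssoc ι' κ' μ').injective) _ _ i j).trans ?_
  exact MonoidalCategory.associator_naturality _ _ _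

theorem left_naturality [Fintype ι] [Fintype κ] {X : ι → C} {Y : κ → C} (f : Mtx X Y) :
    mul (tens (one (unitFam C)) f) (leftHom Y) = mul (leftHom X) f := by
  refine mtx_ext (fun i : PUnit.{1} × κ => i.2) ((Equiv.punitProd κ).surjective) fun i j => ?_
  rw [leftHom, leftHom, reindex_mul]
  refine (mul_reindex (fun i : PUnit.{1} × κ => i.2) ((Equiv.punitProd κ).injective) _ _ i j).trans ?_
  simp only [tens, one_self, MonoidalCategory.id_tensorHom]
  exact MonoidalCategory.leftUnitor_naturality _

theorem right_naturality [Fintype ι] [Fintype κ] {X : ι → C} {Y : κ → C} (f : Mtx X Y) :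
    mul (tens f (one (unitFam C))) (rightHom Y) = mul (rightHom X) f := by
  refine mtx_ext (fun i : κ × PUnit.{1} => i.1) ((Equiv.prodPUnit κ).surjective) fun i j => ?_
  rw [rightHom, rightHom, reindex_mul]
  refine (mul_reindex (fun i : κ × PUnit.{1} => i.1) ((Equiv.prodPUnit κ).injective) _ _ i j).trans ?_
  simp only [tens, one_self, MonoidalCategory.tensorHom_id]
  exact MonoidalCategory.rightUnitor_naturality _

variable [MonoidalPreadditive C]

theorem reindex_tens {X : ι → C} {Y : κ → C} {X' : ι' → C} {Y' : κ' → C} (σ : ι → κ)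
    (φ : ∀ i, X i ⟶ Y (σ i)) (τ : ι' → κ') (ψ : ∀ i, X' i ⟶ Y' (τ i)) :
    tens (reindex σ φ) (reindex τ ψ) =
      reindex (X := tensFam X X') (Y := tensFam Y Y') (Prod.map σ τ)
        (fun i => φ i.1 ⊗ₘ ψ i.2) := by
  funext ⟨i, i'⟩ ⟨j, j'⟩
  simp only [tens]
  by_cases h : σ i = j
  · by_cases h' : τ i' = j'
    · subst h h'
      rw [reindex_self, reindex_self]
      exact (reindex_self (X := tensFam X X') (Y := tensFam Y Y') (Prod.map σ τ)
        (fun i => φ i.1 ⊗ₘ ψ i.2) (i, i')).symm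
    · rw [reindex_of_ne τ _ h', MonoidalPreadditive.tensor_zero, reindex_of_ne]
      exact fun hh => h' (congrArg Prod.snd hh)
  · rw [reindex_of_ne σ _ h, MonoidalPreadditive.zero_tensor, reindex_of_ne]
    exact fun hh => h (congrArg Prod.fst hh)

theorem one_tens_one (X : ι → C) (Y : κ → C) : tens (one X) (one Y) = one (tensFam X Y) := by
  rw [one_eq_reindex, one_eq_reindex, reindex_tens, one_eq_reindex]
  congr 1
  funext i
  exact MonoidalCategory.id_tensorHom_id _ _

theorem tens_mul_tens [Fintype κ] [Fintype κ'] {X : ι → C} {Y : κ → C} {Z : μ → C} {X' : ι' → C}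
    {Y' : κ' → C} {Z' : μ' → C} (f : Mtx X Y) (f' : Mtx X' Y') (g : Mtx Y Z) (g' : Mtx Y' Z') :
    mul (tens f f') (tens g g') = tens (mul f g) (mul f' g') := by
  funext i k
  simp only [tens, mul, sum_tensor, tensor_sum, MonoidalCategory.tensorHom_comp_tensorHom,
    Fintype.sum_prod_type]
  exact Finset.sum_comm

theorem pentagon [Fintype ι] [Fintype κ] [Fintype μ] [Fintype ν] (W : ι → C) (X : κ → C) (Y : μ → C)
    (Z : ν → C) :
    mul (tens (assocHom W X Y) (one Z))
      (mul (assocHom W (tensFam X Y) Z) (tens (one W) (assocHom X Y Z))) =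
    mul (assocHom (tensFam W X) Y Z) (assocHom W X (tensFam Y Z)) := by
  simp only [one_eq_reindex, assocHom, reindex_tens, reindex_mul_reindex]
  congr 1
  funext i
  simp

theorem triangle [Fintype ι] [Fintype κ] (X : ι → C) (Y : κ → C) :
    mul (assocHom X (unitFam C) Y) (tens (one X) (leftHom Y)) = tens (rightHom X) (one Y) := by
  simp only [one_eq_reindex, assocHom, leftHom, rightHom, reindex_tens, reindex_mul_reindex]
  congr 1
  funext i
  simp

theorem hexagon_forward [BraidedCategory C] [Fintype ι] [Fintype κ] [Fintype μ] (X : ι → C)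
    (Y : κ → C) (Z : μ → C) :
    mul (assocHom X Y Z) (mul (braidHom X (tensFam Y Z)) (assocHom Y Z X)) =
      mul (tens (braidHom X Y) (one Z))
        (mul (assocHom Y X Z) (tens (one Y) (braidHom X Z))) := by
  simp only [one_eq_reindex, assocHom, braidHom, reindex_tens, reindex_mul_reindex,
    MonoidalCategory.tensorHom_id, MonoidalCategory.id_tensorHom]
  congr 1
  funext i
  exact BraidedCategory.hexagon_forward _ _ _

theorem hexagon_reverse [BraidedCategory C] [Fintype ι] [Fintype κ] [Fintype μ] (X : ι → C)
    (Y : κ → C) (Z : μ → C) :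
    mul (assocInv X Y Z) (mul (braidHom (tensFam X Y) Z) (assocInv Z X Y)) =
      mul (tens (one X) (braidHom Y Z))
        (mul (assocInv X Z Y) (tens (braidHom X Z) (one Y))) := by
  simp only [one_eq_reindex, assocInv, braidHom, reindex_tens, reindex_mul_reindex,
    MonoidalCategory.tensorHom_id, MonoidalCategory.id_tensorHom]
  congr 1
  funext i
  exact BraidedCategory.hexagon_reverse _ _ _

theorem symmetry [SymmetricCategory C] [Fintype ι] [Fintype κ] (X : ι → C) (Y : κ → C) :
    mul (braidHom X Y) (braidHom Y X) = one _ := by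
  rw [braidHom, braidHom, reindex_mul_reindex, one_eq_reindex]
  congr 1
  funext i
  exact SymmetricCategory.symmetry _ _

section Dual

variable [RightRigidCategory C]

/-- The dual of a tuple of objects is the tuple of the duals. -/
abbrev dualFam (X : ι → C) : ι → C := fun i => (X i)ᘁ

/-- The coevaluation consists of the coevaluations of the entries. -/
def coev (X : ι → C) : Mtx (unitFam C) (tensFam X (dualFam X)) :=
  fun _ i => η_ (X i.1) (X i.1)ᘁ ≫ (X i.1 ◁ one (dualFam X) i.1 i.2)

/-- The evaluation consists of the evaluations of the entries. -/
def ev (X : ι → C) : Mtx (tensFam (dualFam X) X) (unitFam C) :=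
  fun i _ => (one (dualFam X) i.1 i.2 ▷ X i.2) ≫ ε_ (X i.2) (X i.2)ᘁ

theorem coev_self (X : ι → C) (i : ι) : coev X PUnit.unit (i, i) = η_ (X i) (X i)ᘁ := by
  simp [coev, one_self]

theorem coev_of_ne (X : ι → C) {i j : ι} (h : i ≠ j) : coev X PUnit.unit (i, j) = 0 := by
  simp [coev, one_of_ne _ h]

theorem ev_self (X : ι → C) (i : ι) : ev X (i, i) PUnit.unit = ε_ (X i) (X i)ᘁ := by
  simp [ev, one_self]

theorem ev_of_ne (X : ι → C) {i j : ι} (h : i ≠ j) : ev X (i, j) PUnit.unit = 0 := by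
  simp [ev, one_of_ne _ h]

theorem zigzag_right [Fintype ι] (X : ι → C) :
    mul (tens (one (dualFam X)) (coev X)) (mul (assocInv (dualFam X) X (dualFam X))
      (tens (ev X) (one (dualFam X)))) = mul (rightHom (dualFam X)) (leftInv (dualFam X)) := by
  funext ⟨k, ⟨⟩⟩ ⟨⟨⟩, l⟩
  rw [rightHom, reindex_mul, mul, Finset.sum_eq_single (k, (k, k))]
  · rw [assocInv, reindex_mul]
    simp only [tens, one_self, coev_self, ev_self]
    by_cases h : k = l
    · subst h
      have h1 : leftInv (dualFam X) k (PUnit.unit, k) = (λ_ (dualFam X k)).inv :=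
        reindex_self (Y := tensFam (unitFam C) (dualFam X)) (fun i => (PUnit.unit, i)) _ k
      rw [h1, one_self, MonoidalCategory.id_tensorHom, MonoidalCategory.tensorHom_id]
      exact ExactPairing.coevaluation_evaluation _ _
    · have h1 : leftInv (dualFam X) k (PUnit.unit, l) = 0 :=
        reindex_of_ne (Y := tensFam (unitFam C) (dualFam X)) (fun i => (PUnit.unit, i)) _
          (fun hh => h (congrArg Prod.snd hh))
      rw [h1, one_of_ne _ h]
      simp
  · rintro ⟨a, b, c⟩ - hne
    rw [assocInv, reindex_mul]
    simp only [tens]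
    by_cases h1 : k = a
    · subst h1
      by_cases h2 : b = c
      · subst h2
        by_cases h3 : k = b
        · subst h3
          exact absurd rfl hne
        · rw [ev_of_ne _ h3]
          simp
      · rw [coev_of_ne _ h2]
        simp
    · rw [one_of_ne _ h1]
      simp
  · simp

theorem zigzag_left [Fintype ι] (X : ι → C) :
    mul (tens (coev X) (one X)) (mul (assocHom X (dualFam X) X) (tens (one X) (ev X))) =
      mul (leftHom X) (rightInv X) := by
  funext ⟨⟨⟩, k⟩ ⟨l, ⟨⟩⟩
  rw [leftHom, reindex_mul, mul, Finset.sum_eq_single ((k, k), k)]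
  · rw [assocHom, reindex_mul]
    simp only [tens, one_self, coev_self, ev_self]
    by_cases h : k = l
    · subst h
      have h1 : rightInv X k (k, PUnit.unit) = (ρ_ (X k)).inv :=
        reindex_self (Y := tensFam X (unitFam C)) (fun i => (i, PUnit.unit)) _ k
      rw [h1, one_self, MonoidalCategory.id_tensorHom, MonoidalCategory.tensorHom_id]
      exact ExactPairing.evaluation_coevaluation _ _
    · have h1 : rightInv X k (l, PUnit.unit) = 0 :=
        reindex_of_ne (Y := tensFam X (unitFam C)) (fun i => (i, PUnit.unit)) _
          (fun hh => h (congrArg Prod.fst hh))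
      rw [h1, one_of_ne _ h]
      simp
  · rintro ⟨⟨a, b⟩, c⟩ - hne
    rw [assocHom, reindex_mul]
    simp only [tens]
    by_cases h1 : k = c
    · subst h1
      by_cases h2 : a = b
      · subst h2
        by_cases h3 : a = k
        · subst h3
          exact absurd rfl hne
        · rw [ev_of_ne _ h3]
          simp
      · rw [coev_of_ne _ h2]
        simp
    · rw [one_of_ne _ h1]
      simp
  · simp

end Dual

end Matrices

variable {C : Type u} [Category.{v} C] [Preadditive C]

instance {R : Type w} [Semiring R] [Linear R C] : Linear R (Mat_ C) where
  homModule M N := inferInstanceAs (Module R (∀ i j, M.X i ⟶ N.X j))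
  smul_comp _ N _ r f g := by
    funext i k
    change ∑ j : N.ι, (r • f i j) ≫ g j k = r • ∑ j : N.ι, f i j ≫ g j k
    simp [Finset.smul_sum]
  comp_smul _ N _ f r g := by
    funext i k
    change ∑ j : N.ι, f i j ≫ (r • g j k) = r • ∑ j : N.ι, f i j ≫ g j k
    simp [Finset.smul_sum]

variable [MonoidalCategory C]

/-- The tensor product of two tuples of objects is the tuple of the tensor products, and the
tensor product of matrices of morphisms is the Kronecker product. -/
instance : MonoidalCategoryStruct (Mat_ C) where
  tensorObj M N := ⟨M.ι × N.ι, tensFam M.X N.X⟩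
  tensorUnit := ⟨PUnit, unitFam C⟩
  tensorHom f g := tens f g
  whiskerLeft M _ _ f := tens (one M.X) f
  whiskerRight f N := tens f (one N.X)
  associator M N K :=
    { hom := assocHom M.X N.X K.X
      inv := assocInv M.X N.X K.X
      hom_inv_id := assocHom_inv M.X N.X K.X
      inv_hom_id := assocInv_hom M.X N.X K.X }
  leftUnitor M :=
    { hom := leftHom M.X
      inv := leftInv M.X
      hom_inv_id := leftHom_inv M.X
      inv_hom_id := leftInv_hom M.X }
  rightUnitor M :=
    { hom := rightHom M.X
      inv := rightInv M.X
      hom_inv_id := rightHom_inv M.X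
      inv_hom_id := rightInv_hom M.X }

variable [MonoidalPreadditive C]

instance : MonoidalCategory (Mat_ C) :=
  MonoidalCategory.ofTensorHom
    (fun M N => one_tens_one M.X N.X)
    (fun _ _ _ _ => rfl)
    (fun _ _ => rfl)
    (fun f f' g g' => tens_mul_tens f f' g g')
    (fun f g h => assoc_naturality f g h)
    (fun f => left_naturality f)
    (fun f => right_naturality f)
    (fun W X Y Z => pentagon W.X X.X Y.X Z.X)
    (fun X Y => triangle X.X Y.X)

instance : MonoidalPreadditive (Mat_ C) where
  whiskerLeft_zero := funext fun _ => funext fun _ => MonoidalPreadditive.tensor_zero _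
  zero_whiskerRight := funext fun _ => funext fun _ => MonoidalPreadditive.zero_tensor _
  whiskerLeft_add _ _ := funext fun _ => funext fun _ => MonoidalPreadditive.tensor_add _ _ _
  add_whiskerRight _ _ := funext fun _ => funext fun _ => MonoidalPreadditive.add_tensor _ _ _

instance {R : Type w} [Semiring R] [Linear R C] [MonoidalLinear R C] :
    MonoidalLinear R (Mat_ C) where
  whiskerLeft_smul M _ _ r f := funext fun i => funext fun j => by
    change one M.X i.1 j.1 ⊗ₘ (r • f i.2 j.2) = r • (one M.X i.1 j.1 ⊗ₘ f i.2 j.2)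
    simp [MonoidalCategory.tensorHom_def]
  smul_whiskerRight r _ _ f N := funext fun i => funext fun j => by
    change (r • f i.1 j.1) ⊗ₘ one N.X i.2 j.2 = r • (f i.1 j.1 ⊗ₘ one N.X i.2 j.2)
    simp [MonoidalCategory.tensorHom_def]

instance [SymmetricCategory C] : SymmetricCategory (Mat_ C) where
  braiding M N :=
    { hom := braidHom M.X N.X
      inv := braidInv M.X N.X
      hom_inv_id := braidHom_inv M.X N.X
      inv_hom_id := braidInv_hom M.X N.X }
  braiding_naturality_right M _ _ f := braid_naturality (one M.X) f
  braiding_naturality_left f N := braid_naturality f (one N.X)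
  hexagon_forward M N K := hexagon_forward M.X N.X K.X
  hexagon_reverse M N K := hexagon_reverse M.X N.X K.X
  symmetry M N := symmetry M.X N.X

variable [RightRigidCategory C]

/-- The dual of a tuple of objects is the tuple of the duals. -/
def dual (M : Mat_ C) : Mat_ C := ⟨M.ι, dualFam M.X⟩

instance exactPairing (M : Mat_ C) : ExactPairing M (dual M) where
  coevaluation' := coev M.X
  evaluation' := ev M.X
  coevaluation_evaluation' := zigzag_right M.X
  evaluation_coevaluation' := zigzag_left M.X

instance : RightRigidCategory (Mat_ C) where
  rightDual M := { rightDual := dual M }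

end AdditiveEnvelope

/-! ### Tensor products in the Karoubi envelope -/

namespace KaroubiEnvelope

open Idempotents

variable {C : Type u} [Category.{v} C]

instance {R : Type w} [Semiring R] [Preadditive C] [Linear R C] (P Q : Karoubi C) :
    Module R (P ⟶ Q) where
  smul r f := ⟨r • f.f, by simp⟩
  one_smul f := by ext; exact one_smul R f.f
  mul_smul r s f := by ext; exact mul_smul r s f.f
  smul_zero r := by ext; exact smul_zero r
  smul_add r f g := by ext; exact smul_add r f.f g.f
  add_smul r s f := by ext; exact add_smul r s f.f
  zero_smul f := by ext; exact zero_smul R f.f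

@[simp]
theorem smul_f {R : Type w} [Semiring R] [Preadditive C] [Linear R C] {P Q : Karoubi C} (r : R)
    (f : P ⟶ Q) : (r • f).f = r • f.f := rfl

instance {R : Type w} [Semiring R] [Preadditive C] [Linear R C] : Linear R (Karoubi C) where
  homModule _ _ := inferInstance
  smul_comp _ _ _ r f g := by ext; simp
  comp_smul _ _ _ f r g := by ext; simp

variable [MonoidalCategory C]

/-- The tensor product of two formal direct factors. -/
abbrev tensObj (P Q : Karoubi C) : Karoubi C where
  X := P.X ⊗ Q.X
  p := P.p ⊗ₘ Q.p
  idem := by rw [MonoidalCategory.tensorHom_comp_tensorHom, P.idem, Q.idem]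

/-- The tensor product of morphisms. -/
abbrev tensHom {P Q P' Q' : Karoubi C} (f : P ⟶ Q) (g : P' ⟶ Q') : tensObj P P' ⟶ tensObj Q Q' where
  f := f.f ⊗ₘ g.f
  comm := by simp [MonoidalCategory.tensorHom_comp_tensorHom]

/-- A natural isomorphism of the underlying category, cut down to direct factors. -/
abbrev cutIso {P Q : Karoubi C} (e : P.X ≅ Q.X) (h : P.p ≫ e.hom = e.hom ≫ Q.p) : P ≅ Q where
  hom := ⟨P.p ≫ e.hom, by rw [h, Category.assoc, Q.idem, ← h, P.idem_assoc]⟩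
  inv := ⟨Q.p ≫ e.inv, by
    have h' : e.inv ≫ P.p = Q.p ≫ e.inv := by
      rw [Iso.inv_comp_eq, ← Category.assoc, ← h, Category.assoc, e.hom_inv_id, Category.comp_id]
    rw [Category.assoc, h', Q.idem_assoc, Q.idem_assoc]⟩
  hom_inv_id := by
    ext
    simp only [Karoubi.comp_f, Karoubi.id_f]
    rw [h, Category.assoc, Q.idem_assoc, ← Category.assoc, ← h, Category.assoc, e.hom_inv_id,
      Category.comp_id]
  inv_hom_id := by
    have h' : e.inv ≫ P.p = Q.p ≫ e.inv := by
      rw [Iso.inv_comp_eq, ← Category.assoc, ← h, Category.assoc, e.hom_inv_id, Category.comp_id]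
    ext
    simp only [Karoubi.comp_f, Karoubi.id_f]
    rw [← h', Category.assoc, P.idem_assoc, ← Category.assoc, h', Category.assoc, e.inv_hom_id,
      Category.comp_id]

instance : MonoidalCategoryStruct (Karoubi C) where
  tensorObj P Q := tensObj P Q
  tensorUnit := ⟨𝟙_ C, 𝟙 _, Category.comp_id _⟩
  tensorHom f g := tensHom f g
  whiskerLeft P _ _ f := tensHom (𝟙 P) f
  whiskerRight f Q := tensHom f (𝟙 Q)
  associator P Q R := cutIso (P := tensObj (tensObj P Q) R) (Q := tensObj P (tensObj Q R))
    (α_ P.X Q.X R.X) (MonoidalCategory.associator_naturality _ _ _)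
  leftUnitor P := cutIso (P := tensObj ⟨𝟙_ C, 𝟙 _, Category.comp_id _⟩ P) (Q := P) (λ_ P.X) (by simp)
  rightUnitor P := cutIso (P := tensObj P ⟨𝟙_ C, 𝟙 _, Category.comp_id _⟩) (Q := P) (ρ_ P.X) (by simp)

theorem tensor_X (P Q : Karoubi C) : (P ⊗ Q).X = P.X ⊗ Q.X := rfl
theorem tensor_p (P Q : Karoubi C) : (P ⊗ Q).p = P.p ⊗ₘ Q.p := rfl
theorem unit_X : (𝟙_ (Karoubi C)).X = 𝟙_ C := rfl
theorem unit_p : (𝟙_ (Karoubi C)).p = 𝟙 (𝟙_ C) := rfl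
theorem tensorHom_f {P Q P' Q' : Karoubi C} (f : P ⟶ Q) (g : P' ⟶ Q') :
    (f ⊗ₘ g).f = f.f ⊗ₘ g.f := rfl
theorem whiskerLeft_f (P : Karoubi C) {Q Q' : Karoubi C} (f : Q ⟶ Q') :
    (P ◁ f).f = P.p ⊗ₘ f.f := rfl
theorem whiskerRight_f {P P' : Karoubi C} (f : P ⟶ P') (Q : Karoubi C) :
    (f ▷ Q).f = f.f ⊗ₘ Q.p := rfl
theorem associator_hom_f (P Q R : Karoubi C) :
    (α_ P Q R).hom.f = ((P.p ⊗ₘ Q.p) ⊗ₘ R.p) ≫ (α_ P.X Q.X R.X).hom := rfl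
theorem associator_inv_f (P Q R : Karoubi C) :
    (α_ P Q R).inv.f = (P.p ⊗ₘ (Q.p ⊗ₘ R.p)) ≫ (α_ P.X Q.X R.X).inv := rfl
theorem leftUnitor_hom_f (P : Karoubi C) : (λ_ P).hom.f = (𝟙 (𝟙_ C) ⊗ₘ P.p) ≫ (λ_ P.X).hom := rfl
theorem leftUnitor_inv_f (P : Karoubi C) : (λ_ P).inv.f = P.p ≫ (λ_ P.X).inv := rfl
theorem rightUnitor_hom_f (P : Karoubi C) : (ρ_ P).hom.f = (P.p ⊗ₘ 𝟙 (𝟙_ C)) ≫ (ρ_ P.X).hom := rfl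
theorem rightUnitor_inv_f (P : Karoubi C) : (ρ_ P).inv.f = P.p ≫ (ρ_ P.X).inv := rfl

instance : MonoidalCategory (Karoubi C) :=
  MonoidalCategory.ofTensorHom
    (fun _ _ => rfl)
    (fun _ _ _ _ => rfl)
    (fun _ _ => rfl)
    (fun f₁ f₂ g₁ g₂ => Karoubi.hom_ext _ _
      (MonoidalCategory.tensorHom_comp_tensorHom f₁.f f₂.f g₁.f g₂.f))
    (fun {X₁ X₂ X₃ Y₁ Y₂ Y₃} f g h => Karoubi.hom_ext _ _ <| by
      change ((f.f ⊗ₘ g.f) ⊗ₘ h.f) ≫ ((Y₁.p ⊗ₘ Y₂.p) ⊗ₘ Y₃.p) ≫ (α_ _ _ _).hom =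
        (((X₁.p ⊗ₘ X₂.p) ⊗ₘ X₃.p) ≫ (α_ _ _ _).hom) ≫ (f.f ⊗ₘ (g.f ⊗ₘ h.f))
      rw [Category.assoc, ← MonoidalCategory.associator_naturality]
      simp only [← Category.assoc, MonoidalCategory.tensorHom_comp_tensorHom]
      simp)
    (fun {X Y} f => Karoubi.hom_ext _ _ <| by
      change (𝟙 (𝟙_ C) ⊗ₘ f.f) ≫ (𝟙 (𝟙_ C) ⊗ₘ Y.p) ≫ (λ_ _).hom =
        ((𝟙 (𝟙_ C) ⊗ₘ X.p) ≫ (λ_ _).hom) ≫ f.f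
      simp)
    (fun {X Y} f => Karoubi.hom_ext _ _ <| by
      change (f.f ⊗ₘ 𝟙 (𝟙_ C)) ≫ (Y.p ⊗ₘ 𝟙 (𝟙_ C)) ≫ (ρ_ _).hom =
        ((X.p ⊗ₘ 𝟙 (𝟙_ C)) ≫ (ρ_ _).hom) ≫ f.f
      simp)
    (fun W X Y Z => Karoubi.hom_ext _ _ <| by
      change ((((W.p ⊗ₘ X.p) ⊗ₘ Y.p) ≫ (α_ _ _ _).hom) ⊗ₘ Z.p) ≫
        (((W.p ⊗ₘ (X.p ⊗ₘ Y.p)) ⊗ₘ Z.p) ≫ (α_ _ _ _).hom) ≫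
        (W.p ⊗ₘ (((X.p ⊗ₘ Y.p) ⊗ₘ Z.p) ≫ (α_ _ _ _).hom)) =
        ((((W.p ⊗ₘ X.p) ⊗ₘ Y.p) ⊗ₘ Z.p) ≫ (α_ _ _ _).hom) ≫
        (((W.p ⊗ₘ X.p) ⊗ₘ (Y.p ⊗ₘ Z.p)) ≫ (α_ _ _ _).hom)
      have e₁ : (((W.p ⊗ₘ X.p) ⊗ₘ Y.p) ≫ (α_ W.X X.X Y.X).hom) ⊗ₘ Z.p =
          (((W.p ⊗ₘ X.p) ⊗ₘ Y.p) ⊗ₘ Z.p) ≫ ((α_ W.X X.X Y.X).hom ⊗ₘ 𝟙 Z.X) := by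
        rw [MonoidalCategory.tensorHom_comp_tensorHom, Category.comp_id]
      have e₂ : W.p ⊗ₘ (((X.p ⊗ₘ Y.p) ⊗ₘ Z.p) ≫ (α_ X.X Y.X Z.X).hom) =
          (W.p ⊗ₘ ((X.p ⊗ₘ Y.p) ⊗ₘ Z.p)) ≫ (𝟙 W.X ⊗ₘ (α_ X.X Y.X Z.X).hom) := by
        rw [MonoidalCategory.tensorHom_comp_tensorHom, Category.comp_id]
      have e₃ : ((α_ W.X X.X Y.X).hom ⊗ₘ 𝟙 Z.X) ≫ ((W.p ⊗ₘ (X.p ⊗ₘ Y.p)) ⊗ₘ Z.p) =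
          (((W.p ⊗ₘ X.p) ⊗ₘ Y.p) ⊗ₘ Z.p) ≫ ((α_ W.X X.X Y.X).hom ⊗ₘ 𝟙 Z.X) := by
        rw [MonoidalCategory.tensorHom_comp_tensorHom, MonoidalCategory.tensorHom_comp_tensorHom,
          MonoidalCategory.associator_naturality, Category.comp_id, Category.id_comp]
      have e₄ : (((W.p ⊗ₘ X.p) ⊗ₘ Y.p) ⊗ₘ Z.p) ≫ (((W.p ⊗ₘ X.p) ⊗ₘ Y.p) ⊗ₘ Z.p) =
          ((W.p ⊗ₘ X.p) ⊗ₘ Y.p) ⊗ₘ Z.p := by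
        simp only [MonoidalCategory.tensorHom_comp_tensorHom, Karoubi.idem]
      have pent : ((α_ W.X X.X Y.X).hom ⊗ₘ 𝟙 Z.X) ≫ (α_ W.X (X.X ⊗ Y.X) Z.X).hom ≫
          (𝟙 W.X ⊗ₘ (α_ X.X Y.X Z.X).hom) =
          (α_ (W.X ⊗ X.X) Y.X Z.X).hom ≫ (α_ W.X X.X (Y.X ⊗ Z.X)).hom := by simp
      rw [e₁, e₂]
      simp only [Category.assoc]
      rw [← MonoidalCategory.associator_naturality_assoc, reassoc_of% e₃, reassoc_of% e₃,
        reassoc_of% e₄, reassoc_of% e₄, pent, ← MonoidalCategory.associator_naturality_assoc,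
        reassoc_of% e₄])
    (fun X Y => Karoubi.hom_ext _ _ <| by
      change (((X.p ⊗ₘ 𝟙 (𝟙_ C)) ⊗ₘ Y.p) ≫ (α_ _ _ _).hom) ≫
        (X.p ⊗ₘ ((𝟙 (𝟙_ C) ⊗ₘ Y.p) ≫ (λ_ _).hom)) =
        ((X.p ⊗ₘ 𝟙 (𝟙_ C)) ≫ (ρ_ _).hom) ⊗ₘ Y.p
      have e₁ : X.p ⊗ₘ ((𝟙 (𝟙_ C) ⊗ₘ Y.p) ≫ (λ_ Y.X).hom) =
          (X.p ⊗ₘ (𝟙 (𝟙_ C) ⊗ₘ Y.p)) ≫ (𝟙 X.X ⊗ₘ (λ_ Y.X).hom) := by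
        rw [MonoidalCategory.tensorHom_comp_tensorHom, Category.comp_id]
      have e₂ : ((X.p ⊗ₘ 𝟙 (𝟙_ C)) ≫ (ρ_ X.X).hom) ⊗ₘ Y.p =
          ((X.p ⊗ₘ 𝟙 (𝟙_ C)) ⊗ₘ Y.p) ≫ ((ρ_ X.X).hom ⊗ₘ 𝟙 Y.X) := by
        rw [MonoidalCategory.tensorHom_comp_tensorHom, Category.comp_id]
      have e₄ : ((X.p ⊗ₘ 𝟙 (𝟙_ C)) ⊗ₘ Y.p) ≫ ((X.p ⊗ₘ 𝟙 (𝟙_ C)) ⊗ₘ Y.p) =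
          (X.p ⊗ₘ 𝟙 (𝟙_ C)) ⊗ₘ Y.p := by
        simp only [MonoidalCategory.tensorHom_comp_tensorHom, Karoubi.idem, Category.comp_id]
      have tri : (α_ X.X (𝟙_ C) Y.X).hom ≫ (𝟙 X.X ⊗ₘ (λ_ Y.X).hom) =
          (ρ_ X.X).hom ⊗ₘ 𝟙 Y.X := by simp
      rw [e₁, e₂]
      simp only [Category.assoc]
      rw [← MonoidalCategory.associator_naturality_assoc, reassoc_of% e₄, tri])

instance [Preadditive C] [MonoidalPreadditive C] : MonoidalPreadditive (Karoubi C) where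
  whiskerLeft_zero := Karoubi.hom_ext _ _ (MonoidalPreadditive.tensor_zero _)
  zero_whiskerRight := Karoubi.hom_ext _ _ (MonoidalPreadditive.zero_tensor _)
  whiskerLeft_add _ _ := Karoubi.hom_ext _ _ (MonoidalPreadditive.tensor_add _ _ _)
  add_whiskerRight _ _ := Karoubi.hom_ext _ _ (MonoidalPreadditive.add_tensor _ _ _)

instance {R : Type w} [Semiring R] [Preadditive C] [Linear R C] [MonoidalPreadditive C]
    [MonoidalLinear R C] : MonoidalLinear R (Karoubi C) where
  whiskerLeft_smul P _ _ r f := Karoubi.hom_ext _ _ <| by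
    change P.p ⊗ₘ (r • f.f) = r • (P.p ⊗ₘ f.f)
    simp [MonoidalCategory.tensorHom_def]
  smul_whiskerRight r _ _ f P := Karoubi.hom_ext _ _ <| by
    change (r • f.f) ⊗ₘ P.p = r • (f.f ⊗ₘ P.p)
    simp [MonoidalCategory.tensorHom_def]

theorem braid_naturality [BraidedCategory C] {P Q P' Q' : Karoubi C} (f : P ⟶ Q) (g : P' ⟶ Q') :
    (f.f ⊗ₘ g.f) ≫ (Q.p ⊗ₘ Q'.p) ≫ (β_ Q.X Q'.X).hom =
      ((P.p ⊗ₘ P'.p) ≫ (β_ P.X P'.X).hom) ≫ (g.f ⊗ₘ f.f) := by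
  rw [Category.assoc, ← BraidedCategory.braiding_naturality]
  simp only [← Category.assoc, MonoidalCategory.tensorHom_comp_tensorHom]
  simp

instance [SymmetricCategory C] : SymmetricCategory (Karoubi C) where
  braiding P Q := cutIso (P := tensObj P Q) (Q := tensObj Q P) (β_ P.X Q.X)
    (BraidedCategory.braiding_naturality _ _)
  braiding_naturality_right P _ _ f := Karoubi.hom_ext _ _ (braid_naturality (𝟙 P) f)
  braiding_naturality_left f Q := Karoubi.hom_ext _ _ (braid_naturality f (𝟙 Q))
  hexagon_forward P Q R := Karoubi.hom_ext _ _ <| by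
    change (((P.p ⊗ₘ Q.p) ⊗ₘ R.p) ≫ (α_ _ _ _).hom) ≫
      ((P.p ⊗ₘ (Q.p ⊗ₘ R.p)) ≫ (β_ _ _).hom) ≫ ((Q.p ⊗ₘ R.p) ⊗ₘ P.p) ≫ (α_ _ _ _).hom =
      (((P.p ⊗ₘ Q.p) ≫ (β_ _ _).hom) ⊗ₘ R.p) ≫ (((Q.p ⊗ₘ P.p) ⊗ₘ R.p) ≫ (α_ _ _ _).hom) ≫
      (Q.p ⊗ₘ ((P.p ⊗ₘ R.p) ≫ (β_ _ _).hom))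
    have e₁ : ((P.p ⊗ₘ Q.p) ≫ (β_ P.X Q.X).hom) ⊗ₘ R.p =
        ((P.p ⊗ₘ Q.p) ⊗ₘ R.p) ≫ ((β_ P.X Q.X).hom ⊗ₘ 𝟙 R.X) := by
      rw [MonoidalCategory.tensorHom_comp_tensorHom, Category.comp_id]
    have e₂ : Q.p ⊗ₘ ((P.p ⊗ₘ R.p) ≫ (β_ P.X R.X).hom) =
        (Q.p ⊗ₘ (P.p ⊗ₘ R.p)) ≫ (𝟙 Q.X ⊗ₘ (β_ P.X R.X).hom) := by
      rw [MonoidalCategory.tensorHom_comp_tensorHom, Category.comp_id]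
    have e₃ : ((β_ P.X Q.X).hom ⊗ₘ 𝟙 R.X) ≫ ((Q.p ⊗ₘ P.p) ⊗ₘ R.p) =
        ((P.p ⊗ₘ Q.p) ⊗ₘ R.p) ≫ ((β_ P.X Q.X).hom ⊗ₘ 𝟙 R.X) := by
      rw [MonoidalCategory.tensorHom_comp_tensorHom, MonoidalCategory.tensorHom_comp_tensorHom,
        BraidedCategory.braiding_naturality, Category.comp_id, Category.id_comp]
    have e₄ : ((P.p ⊗ₘ Q.p) ⊗ₘ R.p) ≫ ((P.p ⊗ₘ Q.p) ⊗ₘ R.p) = (P.p ⊗ₘ Q.p) ⊗ₘ R.p := by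
      simp only [MonoidalCategory.tensorHom_comp_tensorHom, Karoubi.idem]
    have hex := BraidedCategory.hexagon_forward P.X Q.X R.X
    rw [← MonoidalCategory.tensorHom_id, ← MonoidalCategory.id_tensorHom] at hex
    rw [e₁, e₂]
    simp only [Category.assoc]
    have n₁ := MonoidalCategory.associator_naturality P.p Q.p R.p
    have n₂ := MonoidalCategory.associator_naturality Q.p P.p R.p
    have n₃ := BraidedCategory.braiding_naturality P.p (Q.p ⊗ₘ R.p)
    simp only [← reassoc_of% n₁, ← reassoc_of% n₂, ← reassoc_of% n₃, reassoc_of% e₃,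
      reassoc_of% e₄, hex]
  hexagon_reverse P Q R := Karoubi.hom_ext _ _ <| by
    change ((P.p ⊗ₘ (Q.p ⊗ₘ R.p)) ≫ (α_ _ _ _).inv) ≫
      (((P.p ⊗ₘ Q.p) ⊗ₘ R.p) ≫ (β_ _ _).hom) ≫ (R.p ⊗ₘ (P.p ⊗ₘ Q.p)) ≫ (α_ _ _ _).inv =
      (P.p ⊗ₘ ((Q.p ⊗ₘ R.p) ≫ (β_ _ _).hom)) ≫ ((P.p ⊗ₘ (R.p ⊗ₘ Q.p)) ≫ (α_ _ _ _).inv) ≫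
      (((P.p ⊗ₘ R.p) ≫ (β_ _ _).hom) ⊗ₘ Q.p)
    have e₁ : P.p ⊗ₘ ((Q.p ⊗ₘ R.p) ≫ (β_ Q.X R.X).hom) =
        (P.p ⊗ₘ (Q.p ⊗ₘ R.p)) ≫ (𝟙 P.X ⊗ₘ (β_ Q.X R.X).hom) := by
      rw [MonoidalCategory.tensorHom_comp_tensorHom, Category.comp_id]
    have e₂ : ((P.p ⊗ₘ R.p) ≫ (β_ P.X R.X).hom) ⊗ₘ Q.p =
        ((P.p ⊗ₘ R.p) ⊗ₘ Q.p) ≫ ((β_ P.X R.X).hom ⊗ₘ 𝟙 Q.X) := by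
      rw [MonoidalCategory.tensorHom_comp_tensorHom, Category.comp_id]
    have e₃ : (𝟙 P.X ⊗ₘ (β_ Q.X R.X).hom) ≫ (P.p ⊗ₘ (R.p ⊗ₘ Q.p)) =
        (P.p ⊗ₘ (Q.p ⊗ₘ R.p)) ≫ (𝟙 P.X ⊗ₘ (β_ Q.X R.X).hom) := by
      rw [MonoidalCategory.tensorHom_comp_tensorHom, MonoidalCategory.tensorHom_comp_tensorHom,
        BraidedCategory.braiding_naturality, Category.comp_id, Category.id_comp]
    have e₄ : (P.p ⊗ₘ (Q.p ⊗ₘ R.p)) ≫ (P.p ⊗ₘ (Q.p ⊗ₘ R.p)) = P.p ⊗ₘ (Q.p ⊗ₘ R.p) := by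
      simp only [MonoidalCategory.tensorHom_comp_tensorHom, Karoubi.idem]
    have hex := BraidedCategory.hexagon_reverse P.X Q.X R.X
    rw [← MonoidalCategory.tensorHom_id, ← MonoidalCategory.id_tensorHom] at hex
    rw [e₁, e₂]
    simp only [Category.assoc]
    have n₁ := MonoidalCategory.associator_inv_naturality P.p Q.p R.p
    have n₂ := MonoidalCategory.associator_inv_naturality P.p R.p Q.p
    have n₃ := BraidedCategory.braiding_naturality (P.p ⊗ₘ Q.p) R.p
    simp only [← reassoc_of% n₁, ← reassoc_of% n₂, ← reassoc_of% n₃, reassoc_of% e₃,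
      reassoc_of% e₄, hex]
  symmetry P Q := Karoubi.hom_ext _ _ <| by
    change ((P.p ⊗ₘ Q.p) ≫ (β_ _ _).hom) ≫ (Q.p ⊗ₘ P.p) ≫ (β_ _ _).hom = P.p ⊗ₘ Q.p
    rw [Category.assoc, ← BraidedCategory.braiding_naturality_assoc, SymmetricCategory.symmetry,
      Category.comp_id, MonoidalCategory.tensorHom_comp_tensorHom, P.idem, Q.idem]

section Dual

variable [RightRigidCategory C]

/-- The dual of a formal direct factor. -/
def dual (P : Karoubi C) : Karoubi C where
  X := P.Xᘁ
  p := P.pᘁ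
  idem := by rw [← comp_rightAdjointMate, P.idem]

theorem coev_mate (P : Karoubi C) :
    η_ P.X P.Xᘁ ≫ (P.p ⊗ₘ P.pᘁ) = η_ P.X P.Xᘁ ≫ P.X ◁ P.pᘁ := by
  rw [MonoidalCategory.tensorHom_def', coevaluation_comp_rightAdjointMate_assoc,
    ← MonoidalCategory.comp_whiskerRight, P.idem, coevaluation_comp_rightAdjointMate]

theorem mate_ev (P : Karoubi C) :
    (P.pᘁ ⊗ₘ P.p) ≫ ε_ P.X P.Xᘁ = (P.pᘁ ▷ P.X) ≫ ε_ P.X P.Xᘁ := by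
  rw [MonoidalCategory.tensorHom_def, Category.assoc, ← rightAdjointMate_comp_evaluation,
    ← MonoidalCategory.comp_whiskerRight_assoc, ← comp_rightAdjointMate, P.idem]

theorem zigzag_right (P : Karoubi C) :
    (P.pᘁ ⊗ₘ (η_ P.X P.Xᘁ ≫ (P.p ⊗ₘ P.pᘁ))) ≫ ((P.pᘁ ⊗ₘ (P.p ⊗ₘ P.pᘁ)) ≫ (α_ _ _ _).inv) ≫
      (((P.pᘁ ⊗ₘ P.p) ≫ ε_ P.X P.Xᘁ) ⊗ₘ P.pᘁ) =
    ((P.pᘁ ⊗ₘ 𝟙 (𝟙_ C)) ≫ (ρ_ _).hom) ≫ P.pᘁ ≫ (λ_ _).inv := by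
  have i₁ : P.pᘁ ≫ P.pᘁ = P.pᘁ := by rw [← comp_rightAdjointMate, P.idem]
  have c := coev_mate P
  set m := rightAdjointMate P.p
  have n := MonoidalCategory.associator_inv_naturality m P.p m
  have e₁ : m ⊗ₘ (η_ P.X P.Xᘁ ≫ (P.p ⊗ₘ m)) = P.Xᘁ ◁ η_ P.X P.Xᘁ ≫ (m ⊗ₘ (P.p ⊗ₘ m)) := by
    rw [← MonoidalCategory.id_tensorHom, MonoidalCategory.tensorHom_comp_tensorHom,
      Category.id_comp]
  have e₂ : ((m ⊗ₘ P.p) ≫ ε_ P.X P.Xᘁ) ⊗ₘ m = ((m ⊗ₘ P.p) ⊗ₘ m) ≫ (ε_ P.X P.Xᘁ ▷ P.Xᘁ) := by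
    rw [← MonoidalCategory.tensorHom_id, MonoidalCategory.tensorHom_comp_tensorHom,
      Category.comp_id]
  have e₃ : (m ⊗ₘ (P.p ⊗ₘ m)) ≫ (m ⊗ₘ (P.p ⊗ₘ m)) = m ⊗ₘ (P.p ⊗ₘ m) := by
    simp only [MonoidalCategory.tensorHom_comp_tensorHom, i₁, P.idem]
  have e₄ : P.Xᘁ ◁ η_ P.X P.Xᘁ ≫ (m ⊗ₘ (P.p ⊗ₘ m)) =
      (m ▷ 𝟙_ C) ≫ P.Xᘁ ◁ η_ P.X P.Xᘁ ≫ P.Xᘁ ◁ P.X ◁ m := by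
    rw [← e₁, c, ← MonoidalCategory.whiskerLeft_comp, ← MonoidalCategory.tensorHom_def]
  rw [e₁, e₂]
  simp only [Category.assoc, ← reassoc_of% n, reassoc_of% e₃]
  rw [reassoc_of% e₄, MonoidalCategory.associator_inv_naturality_right_assoc,
    MonoidalCategory.whisker_exchange, ExactPairing.coevaluation_evaluation_assoc,
    MonoidalCategory.tensorHom_id, MonoidalCategory.leftUnitor_inv_naturality]

theorem zigzag_left (P : Karoubi C) :
    ((η_ P.X P.Xᘁ ≫ (P.p ⊗ₘ P.pᘁ)) ⊗ₘ P.p) ≫ (((P.p ⊗ₘ P.pᘁ) ⊗ₘ P.p) ≫ (α_ _ _ _).hom) ≫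
      (P.p ⊗ₘ ((P.pᘁ ⊗ₘ P.p) ≫ ε_ P.X P.Xᘁ)) =
    ((𝟙 (𝟙_ C) ⊗ₘ P.p) ≫ (λ_ _).hom) ≫ P.p ≫ (ρ_ _).inv := by
  have i₁ : P.pᘁ ≫ P.pᘁ = P.pᘁ := by rw [← comp_rightAdjointMate, P.idem]
  have c : η_ P.X P.Xᘁ ≫ (P.p ⊗ₘ P.pᘁ) = η_ P.X P.Xᘁ ≫ P.p ▷ P.Xᘁ := by
    rw [coev_mate, coevaluation_comp_rightAdjointMate]
  set m := rightAdjointMate P.p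
  have n := MonoidalCategory.associator_naturality P.p m P.p
  have e₁ : (η_ P.X P.Xᘁ ≫ (P.p ⊗ₘ m)) ⊗ₘ P.p = η_ P.X P.Xᘁ ▷ P.X ≫ ((P.p ⊗ₘ m) ⊗ₘ P.p) := by
    rw [← MonoidalCategory.tensorHom_id, MonoidalCategory.tensorHom_comp_tensorHom,
      Category.id_comp]
  have e₂ : P.p ⊗ₘ ((m ⊗ₘ P.p) ≫ ε_ P.X P.Xᘁ) = (P.p ⊗ₘ (m ⊗ₘ P.p)) ≫ (P.X ◁ ε_ P.X P.Xᘁ) := by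
    rw [← MonoidalCategory.id_tensorHom, MonoidalCategory.tensorHom_comp_tensorHom,
      Category.comp_id]
  have e₃ : ((P.p ⊗ₘ m) ⊗ₘ P.p) ≫ ((P.p ⊗ₘ m) ⊗ₘ P.p) = (P.p ⊗ₘ m) ⊗ₘ P.p := by
    simp only [MonoidalCategory.tensorHom_comp_tensorHom, i₁, P.idem]
  have e₄ : η_ P.X P.Xᘁ ▷ P.X ≫ ((P.p ⊗ₘ m) ⊗ₘ P.p) =
      (𝟙_ C ◁ P.p) ≫ η_ P.X P.Xᘁ ▷ P.X ≫ (P.p ▷ P.Xᘁ) ▷ P.X := by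
    rw [← e₁, c, ← MonoidalCategory.comp_whiskerRight, ← MonoidalCategory.tensorHom_def']
  rw [e₁, e₂]
  simp only [Category.assoc, ← reassoc_of% n, reassoc_of% e₃]
  rw [reassoc_of% e₄, MonoidalCategory.associator_naturality_left_assoc,
    ← MonoidalCategory.whisker_exchange, ExactPairing.evaluation_coevaluation_assoc,
    MonoidalCategory.id_tensorHom, MonoidalCategory.rightUnitor_inv_naturality]

instance exactPairing (P : Karoubi C) : ExactPairing P (dual P) where
  coevaluation' :=
    { f := η_ P.X P.Xᘁ ≫ (P.p ⊗ₘ P.pᘁ)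
      comm := by
        change 𝟙 (𝟙_ C) ≫ (η_ P.X P.Xᘁ ≫ (P.p ⊗ₘ P.pᘁ)) ≫ (P.p ⊗ₘ P.pᘁ) = _
        rw [Category.id_comp, Category.assoc, MonoidalCategory.tensorHom_comp_tensorHom,
          ← comp_rightAdjointMate, P.idem]
        rfl }
  evaluation' :=
    { f := (P.pᘁ ⊗ₘ P.p) ≫ ε_ P.X P.Xᘁ
      comm := by
        change (P.pᘁ ⊗ₘ P.p) ≫ ((P.pᘁ ⊗ₘ P.p) ≫ ε_ P.X P.Xᘁ) ≫ 𝟙 (𝟙_ C) = _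
        rw [Category.comp_id, MonoidalCategory.tensorHom_comp_tensorHom_assoc,
          ← comp_rightAdjointMate, P.idem]
        rfl }
  coevaluation_evaluation' := Karoubi.hom_ext _ _ (zigzag_right P)
  evaluation_coevaluation' := Karoubi.hom_ext _ _ (zigzag_left P)

instance : RightRigidCategory (Karoubi C) where
  rightDual P := { rightDual := dual P }

end Dual

end KaroubiEnvelope

/-! ### Ribbon categories, ideals and traces -/

/-- A ribbon category: a braided monoidal category with duals (`Xᘁ` is the dual of `X`, with
coevaluation `η_ X Xᘁ : 𝟙_ C ⟶ X ⊗ Xᘁ` and evaluation `ε_ X Xᘁ : Xᘁ ⊗ X ⟶ 𝟙_ C`) and a twist. -/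
class RibbonCategory (C : Type u) [Category.{v} C] [MonoidalCategory C] [BraidedCategory C]
    [RightRigidCategory C] where
  /-- the twist -/
  twist (X : C) : X ≅ X
  twist_naturality {X Y : C} (f : X ⟶ Y) : f ≫ (twist Y).hom = (twist X).hom ≫ f
  twist_tensor (X Y : C) : (twist (X ⊗ Y)).hom =
    (β_ X Y).hom ≫ (β_ Y X).hom ≫ ((twist X).hom ⊗ₘ (twist Y).hom)
  twist_dual (X : C) : (twist Xᘁ).hom = rightAdjointMate (twist X).hom

/-- A symmetric monoidal category with duals is a ribbon category with trivial twist. -/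
instance RibbonCategory.ofSymmetric (C : Type u) [Category.{v} C] [MonoidalCategory C]
    [SymmetricCategory C] [RightRigidCategory C] : RibbonCategory C where
  twist X := Iso.refl X
  twist_naturality f := by simp
  twist_tensor X Y := by simp
  twist_dual X := by simp

section Traces

variable {C : Type u} [Category.{v} C] [MonoidalCategory C]

/-- An ideal of objects: a full subcategory that is closed under tensor products with arbitrary
objects and under retracts. -/
structure ObjectIdeal (C : Type u) [Category.{v} C] [MonoidalCategory C] where
  /-- the objects of the ideal -/
  mem : ObjectProperty C
  tensor_mem {V : C} (hV : mem V) (W : C) : mem (V ⊗ W)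
  retract_mem {V W : C} (hV : mem V) (r : Retract W V) : mem W

/-- The ideal of all retracts of the objects `J ⊗ X`. -/
def idealOf (J : C) : ObjectIdeal C where
  mem V := ∃ X : C, Nonempty (Retract V (J ⊗ X))
  tensor_mem := by
    rintro V ⟨X, ⟨r⟩⟩ W
    refine ⟨X ⊗ W, ⟨⟨(r.i ▷ W) ≫ (α_ J X W).hom, (α_ J X W).inv ≫ (r.r ▷ W), ?_⟩⟩⟩
    rw [Category.assoc, Iso.hom_inv_id_assoc, ← MonoidalCategory.comp_whiskerRight, r.retract,
      MonoidalCategory.id_whiskerRight]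
  retract_mem := by
    rintro V W ⟨X, ⟨r⟩⟩ s
    exact ⟨X, ⟨s.trans r⟩⟩

theorem mem_idealOf_self (J : C) : (idealOf J).mem J :=
  ⟨𝟙_ C, ⟨⟨(ρ_ J).inv, (ρ_ J).hom, (ρ_ J).inv_hom_id⟩⟩⟩

variable [BraidedCategory C] [RightRigidCategory C] [RibbonCategory C]

/-- The morphism `ev'_W : W ⊗ W* ⟶ 𝟙`, the composite of twist, braiding and evaluation. -/
def evalTwisted (W : C) : W ⊗ Wᘁ ⟶ 𝟙_ C :=
  ((RibbonCategory.twist W).hom ▷ Wᘁ) ≫ (β_ W Wᘁ).hom ≫ ε_ W Wᘁ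

/-- The right partial trace of an endomorphism of `V ⊗ W`, an endomorphism of `V`. -/
def partialTraceRight {V W : C} (f : V ⊗ W ⟶ V ⊗ W) : V ⟶ V :=
  (ρ_ V).inv ≫ (V ◁ η_ W Wᘁ) ≫ (α_ V W Wᘁ).inv ≫ (f ▷ Wᘁ) ≫ (α_ V W Wᘁ).hom ≫
    (V ◁ evalTwisted W) ≫ (ρ_ V).hom

/-- A trace on an ideal `I` of a `K`-linear ribbon category: a family of linear functions on the
endomorphism spaces of the objects of `I` that is compatible with right partial traces and
cyclic. -/
@[ext]
structure ModifiedTrace (K : Type w) [Field K] [Preadditive C] [Linear K C]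
    (I : ObjectIdeal C) where
  /-- the function on the endomorphisms of an object of the ideal -/
  tr (V : C) (hV : I.mem V) : (V ⟶ V) →ₗ[K] K
  tr_tensor (U W : C) (hU : I.mem U) (f : U ⊗ W ⟶ U ⊗ W) :
    tr (U ⊗ W) (I.tensor_mem hU W) f = tr U hU (partialTraceRight f)
  tr_comm (U V : C) (hU : I.mem U) (hV : I.mem V) (f : V ⟶ U) (g : U ⟶ V) :
    tr V hV (f ≫ g) = tr U hU (g ≫ f)

end Traces

/-! ### Deligne's category -/

/-- Deligne's category `Rep(S_t; F)`: the Karoubi envelope of the additive envelope of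
`Rep₀(S_t; F)`. -/
abbrev DeligneCat (F : Type u) [Field F] (t : F) : Type _ :=
  Idempotents.Karoubi (Mat_ (RepZero F t))

namespace DeligneCat

variable {F : Type u} [Field F] {t : F}

/-- The object `([A], e)` of Deligne's category, for an idempotent endomorphism `e` of `[A]`. -/
def summand (A : RepZero F t) (e : A ⟶ A) (he : e ≫ e = e) : DeligneCat F t where
  X := (Mat_.embedding _).obj A
  p := (Mat_.embedding _).map e
  idem := by rw [← Functor.map_comp, he]

/-- A primitive idempotent: a nonzero idempotent that is not the sum of two nonzero orthogonal
idempotents. -/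
def IsPrimitiveIdempotent {A : RepZero F t} (e : A ⟶ A) : Prop :=
  e ≠ 0 ∧ e ≫ e = e ∧ ∀ f g : A ⟶ A, f ≫ f = f → g ≫ g = g → f ≫ g = 0 → g ≫ f = 0 →
    f + g = e → f = 0 ∨ g = 0

/-- The object `[1]`, whose endomorphism algebra is the partition algebra `FP₁(t)`. -/
abbrev pt (F : Type u) (t : F) : RepZero F t := ⟨Unit⟩

/-- `L` is (isomorphic to) the indecomposable object `L(□)`: the image of a primitive idempotent
of the partition algebra `FP₁(t)` whose image in `F S₁ = F` (the coefficient of the identity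
diagram) is not zero. -/
def IsLBox (L : DeligneCat F t) : Prop :=
  ∃ (e : pt F t ⟶ pt F t) (he : IsPrimitiveIdempotent e),
    RepZero.coeff e (PartitionDiagram.graph (Equiv.refl Unit)) ≠ 0 ∧
      Nonempty (L ≅ summand (pt F t) e he.2.1)

end DeligneCat

end

/-!
At `t = 0` the algebra `End([1])` has the basis `1`, `x` with `x` the disconnected diagram and
`x ^ 2 = 0`. It is local, hence `L(□)` is the object `[1]` itself
(`DeligneCat.IsLBox.nonempty_iso_point`), and every object of its ideal is a retract of some
`[1] ⊗ X`, whose entries `[A]` all have `A` nonempty.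

*Existence.* For generic `t` the categorical trace of an endomorphism diagram of `[A]` is `t ^ c`,
where `c` is the number of components of its closure. When `A` is nonempty, `c ≥ 1`, and
`t ^ c / t` at `t = 0` is `1` if the closure is connected and `0` otherwise. This is `closureTrace`.
Cyclicity (`closureTrace_compLin_comm`) and compatibility with partial traces
(`RepZero.closureTrace_partialTraceRight`) are verified by counting components, including those
removed from the middle row; the counting is done through the number `2 ^ c` of `Bool`-valued
labellings, which turns composition into multiplication of matrices. The trace of a matrix is the
sum over its diagonal entries, and partial traces in the additive and the Karoubi envelopes reduce
to those of the entries (`AdditiveEnvelope.partialTraceRight_apply_self`,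
`KaroubiEnvelope.partialTraceRight_f`). Cyclicity then extends the trace to all retracts
(`DeligneCat.closureModifiedTrace`).

*Uniqueness.* The two axioms express the trace on the ideal through its values on `End([1])`
(`ModifiedTrace.ext_of_tr_eq`), and force the values at `1` and `x` to agree
(`DeligneCat.tr_pointEnd_bot`).
-/

/-! ### The closure of a diagram -/

namespace PartitionDiagram

variable {F : Type u} [Field F] {A B C : Type}

open scoped Classical in
/-- The linear function on `End([A])` whose value at a diagram is `1` if identifying the two rows of
the diagram gives a connected graph, and `0` otherwise. For `c` components there are `2 ^ c`
compatible labellings by `Bool`, so connectedness is the condition that there are two of them. -/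
noncomputable def closureTrace : Lin F A A →ₗ[F] F :=
  Finsupp.linearCombination F fun p => if Nat.card {a : A → Bool // Compat p a a} = 2 then 1 else 0

theorem Diag.sum_sem_self [Fintype (A → Bool)] (x : Diag A A) :
    ∑ a : A → Bool, x.sem a a = 2 ^ x.1 * Nat.card {a : A → Bool // Compat x.2 a a} := by
  classical
  rw [Nat.card_eq_fintype_card, Fintype.card_subtype, Finset.card_filter, Finset.mul_sum]
  simp [Diag.sem, ind]

theorem two_le_card_compat_self [Finite A] [Nonempty A] (p : Setoid (A ⊕ A)) :
    2 ≤ Nat.card {a : A → Bool // Compat p a a} := by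
  have hc : ∀ b : Bool, Compat p (fun _ : A => b) (fun _ => b) := by
    rintro b (x | x) (y | y) _ <;> rfl
  have := Nat.card_le_card_of_injective
    (fun b : Bool => (⟨fun _ => b, hc b⟩ : {a : A → Bool // Compat p a a}))
    (fun b b' h => congrFun (congrArg Subtype.val h) (Classical.arbitrary A))
  simpa using this

/-- With closed components taken into account, the function still only tests whether the total
number of components is `1`: on a nonempty set the closure of a diagram has a component, so that a
further closed component gives total at least `2`, in accordance with its weight `0`. -/
theorem closureTrace_diagLin [Finite A] [Nonempty A] [Fintype (A → Bool)] (x : Diag A A) :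
    closureTrace (diagLin (0 : F) x) = if ∑ a : A → Bool, x.sem a a = 2 then 1 else 0 := by
  classical
  have h2 := two_le_card_compat_self x.2
  rw [Diag.sum_sem_self, closureTrace, diagLin, Finsupp.linearCombination_single, smul_eq_mul]
  rcases Nat.eq_zero_or_pos x.1 with h | h
  · simp [h]
  · have h1 : 2 ≤ 2 ^ x.1 := Nat.le_self_pow h.ne' 2
    rw [zero_pow h.ne', zero_mul, if_neg]
    nlinarith

/-- Cyclicity: both composites close up to the same picture. Nonemptiness of both sets is needed:
through `∅` the composite in one order loses a component at parameter zero. -/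
theorem closureTrace_compLin_comm [Finite A] [Finite B] [Nonempty A] [Nonempty B] (f : Lin F A B)
    (g : Lin F B A) :
    closureTrace (compLin 0 f g) = closureTrace (compLin 0 g f) := by
  have := Fintype.ofFinite (A → Bool)
  have := Fintype.ofFinite (B → Bool)
  induction f using lin_induction (0 : F) with
  | h0 => simp
  | hadd f f' h1 h2 => simp [h1, h2]
  | hsmul a f h1 => simp [h1]
  | hd x =>
  induction g using lin_induction (0 : F) with
  | h0 => simp
  | hadd f f' h1 h2 => simp [h1, h2]
  | hsmul a f h1 => simp [h1]
  | hd y =>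
  simp only [compLin_diagLin, closureTrace_diagLin, Diag.sem_comp]
  rw [Finset.sum_comm]
  simp only [mul_comm]

/-- The diagram obtained by joining the `B`-parts of the two rows of a diagram. It is written as the
composite of the diagrams that occur in the definition of the right partial trace. -/
noncomputable def Diag.partialClosure (x : Diag (A ⊕ B) (C ⊕ B)) : Diag A C :=
  (graph (Equiv.sumEmpty A Empty).symm).comp
    (((graph (Equiv.refl A)).tensor (0, cup B)).comp
      ((graph (Equiv.sumAssoc A B B).symm).comp
        ((x.tensor (graph (Equiv.refl B))).comp
          ((graph (Equiv.sumAssoc C B B)).comp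
            (((graph (Equiv.refl C)).tensor ((graph (Equiv.sumComm B B)).comp (0, cap B))).comp
              (graph (Equiv.sumEmpty C Empty)))))))

/-- Labellings of the closed-up strands are summed over, as in a partial trace of matrices. -/
theorem Diag.sem_partialClosure [Finite A] [Finite B] [Finite C] (x : Diag (A ⊕ B) (C ⊕ B))
    {X : Type} [Finite X] [Fintype (B → X)] (a : A → X) (c : C → X) :
    x.partialClosure.sem a c = ∑ b : B → X, x.sem (Sum.elim a b) (Sum.elim c b) := by
  classical
  have := Fintype.ofFinite (C → X)
  have := Fintype.ofFinite (A → X)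
  have := Fintype.ofFinite (A ⊕ (B ⊕ B) → X)
  have := Fintype.ofFinite ((C ⊕ B) ⊕ B → X)
  rw [partialClosure, sem_graph_comp, sem_comp]
  have hcup : ∀ (a : A ⊕ Empty → X) (z : A ⊕ (B ⊕ B) → X),
      (Diag.tensor (graph (Equiv.refl A)) (0, cup B)).sem a z =
        if a ∘ Sum.inl = z ∘ Sum.inl ∧ z ∘ Sum.inr ∘ Sum.inl = z ∘ Sum.inr ∘ Sum.inr
          then 1 else 0 := by
    intro a z
    rw [sem_tensor, sem_graph]
    simp only [sem, ind, compat_cup, pow_zero, one_mul]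
    rw [ite_zero_mul_ite_zero, mul_one]
    rfl
  have hcap : ∀ (z : (C ⊕ B) ⊕ B → X) (c : C → X),
      ((graph (Equiv.sumAssoc C B B)).comp
            (((graph (Equiv.refl C)).tensor ((graph (Equiv.sumComm B B)).comp (0, cap B))).comp
              (graph (Equiv.sumEmpty C Empty)))).sem z c =
        if z ∘ Sum.inl ∘ Sum.inl = c ∧ z ∘ Sum.inl ∘ Sum.inr = z ∘ Sum.inr then 1 else 0 := by
    intro z c
    rw [sem_graph_comp, sem_comp_graph, sem_tensor, sem_graph, sem_graph_comp]
    simp only [sem, ind, compat_cap, pow_zero, one_mul]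
    rw [ite_zero_mul_ite_zero, mul_one]
    refine if_congr (and_congr Iff.rfl eq_comm) rfl rfl
  have hmid : ∀ z : A ⊕ (B ⊕ B) → X, ((graph (Equiv.sumAssoc A B B).symm).comp
        ((x.tensor (graph (Equiv.refl B))).comp
          ((graph (Equiv.sumAssoc C B B)).comp
            (((graph (Equiv.refl C)).tensor ((graph (Equiv.sumComm B B)).comp (0, cap B))).comp
              (graph (Equiv.sumEmpty C Empty)))))).sem z c =
        x.sem (Sum.elim (z ∘ Sum.inl) (z ∘ Sum.inr ∘ Sum.inl))
          (Sum.elim c (z ∘ Sum.inr ∘ Sum.inr)) := by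
    intro z
    rw [sem_graph_comp, sem_comp, Finset.sum_eq_single
      (Sum.elim (Sum.elim c (z ∘ Sum.inr ∘ Sum.inr)) (z ∘ Sum.inr ∘ Sum.inr))]
    · rw [hcap, if_pos ⟨rfl, rfl⟩, mul_one, sem_tensor, sem_graph, if_pos, mul_one]
      · congr 1
        funext y; rcases y with y | y <;> rfl
      · rfl
    · intro y _ hy
      rw [hcap, sem_tensor, sem_graph]
      by_contra hne
      simp only [mul_eq_zero, not_or, ite_eq_right_iff, not_forall] at hne
      obtain ⟨⟨-, h1, -⟩, ⟨h2, h3⟩, -⟩ := hne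
      apply hy
      funext w
      rcases w with (w | w) | w
      · exact congrFun h2 w
      · exact (congrFun h3 w).trans (congrFun h1 w).symm
      · exact (congrFun h1 w).symm
    · simp
  simp only [hmid, hcup]
  let i : (B → X) → (A ⊕ (B ⊕ B) → X) := fun b => Sum.elim a (Sum.elim b b)
  have hi : Function.Injective i := fun b b' h => funext fun k => congrFun h (Sum.inr (Sum.inl k))
  symm
  refine Finset.sum_of_injOn i hi.injOn (by simp) ?_ ?_
  · rintro z - hz
    rw [if_neg, zero_mul]
    rintro ⟨h1, h2⟩
    apply hz
    refine ⟨z ∘ Sum.inr ∘ Sum.inl, Finset.mem_coe.2 (Finset.mem_univ _), ?_⟩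
    funext w
    rcases w with w | w | w
    · exact congrFun h1 w
    · rfl
    · exact congrFun h2 w
  · intro b _
    rw [if_pos ⟨rfl, rfl⟩, one_mul]
    rfl

end PartitionDiagram

/-! ### Diagrams on one and two points -/

namespace PartitionDiagram

theorem setoid_eq_graph_or_bot (p : Setoid (Unit ⊕ Unit)) :
    p = graph (Equiv.refl Unit) ∨ p = ⊥ := by
  by_cases h : p (Sum.inl ()) (Sum.inr ())
  · left
    ext (x | x) (y | y)
    · exact iff_of_true (p.refl _) rfl
    · exact iff_of_true h rfl
    · exact iff_of_true (p.symm h) rfl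
    · exact iff_of_true (p.refl _) rfl
  · right
    ext (x | x) (y | y)
    · exact iff_of_true (p.refl _) rfl
    · exact iff_of_false h (by simp)
    · exact iff_of_false (fun h' => h (p.symm h')) (by simp)
    · exact iff_of_true (p.refl _) rfl

theorem graph_refl_unit_ne_bot : graph (Equiv.refl Unit) ≠ ⊥ := by
  intro h
  have : graph (Equiv.refl Unit) (Sum.inl ()) (Sum.inr ()) := rfl
  rw [h] at this
  cases this

theorem lin_unit_eq {F : Type u} [Field F] (f : Lin F Unit Unit) :
    f = f (graph (Equiv.refl Unit)) • Finsupp.single (graph (Equiv.refl Unit)) 1 +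
      f ⊥ • Finsupp.single ⊥ 1 := by
  ext p
  rcases setoid_eq_graph_or_bot p with rfl | rfl
  · simp [graph_refl_unit_ne_bot.symm]
  · simp [graph_refl_unit_ne_bot]

theorem lin_unit_apply {F : Type u} [Field F] (c d : F) :
    (c • Finsupp.single (graph (Equiv.refl Unit)) (1 : F) + d • Finsupp.single ⊥ 1 :
        Lin F Unit Unit) (graph (Equiv.refl Unit)) = c ∧
      (c • Finsupp.single (graph (Equiv.refl Unit)) (1 : F) + d • Finsupp.single ⊥ 1 :
        Lin F Unit Unit) ⊥ = d := by
  simp [graph_refl_unit_ne_bot, graph_refl_unit_ne_bot.symm]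

theorem compat_bot {A B X : Type} (a : A → X) (b : B → X) : Compat ⊥ a b := bot_le

theorem Diag.bot_comp_bot :
    Diag.comp ((0, ⊥) : Diag Unit Unit) (0, ⊥) = ((1, ⊥) : Diag Unit Unit) := by
  refine ext_sem fun X _ a c => ?_
  have := Fintype.ofFinite X
  rw [sem_comp]
  simp [sem, ind, compat_bot]

/-- The diagram on two rows of two points in which the upper two points and the first lower point
form a block, and the second lower point is isolated. Its partial trace is the identity of `[1]`,
and becomes the disconnected diagram after the lower points are exchanged. -/
def mergeDiag : Setoid ((Unit ⊕ Unit) ⊕ (Unit ⊕ Unit)) :=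
  Setoid.ker (Sum.elim (fun _ => true) (Sum.elim (fun _ => true) fun _ => false))

theorem compat_mergeDiag {X : Type} (a b : Unit ⊕ Unit → X) : Compat mergeDiag a b ↔
    a (Sum.inl ()) = a (Sum.inr ()) ∧ a (Sum.inl ()) = b (Sum.inl ()) := by
  constructor
  · intro h
    exact ⟨@h (Sum.inl (Sum.inl ())) (Sum.inl (Sum.inr ())) rfl,
      @h (Sum.inl (Sum.inl ())) (Sum.inr (Sum.inl ())) rfl⟩
  · rintro ⟨h₁, h₂⟩ ((x | x) | (x | x)) ((y | y) | (y | y)) h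
    all_goals first
      | cases (show true = false from h)
      | cases (show false = true from h)
      | simp [← h₁, ← h₂]

theorem Diag.swap_comp_mergeDiag :
    (graph (Equiv.sumComm Unit Unit)).comp (0, mergeDiag) = (0, mergeDiag) := by
  refine ext_sem fun X _ a c => ?_
  rw [sem_graph_comp]
  have h : Compat mergeDiag (a ∘ (Equiv.sumComm Unit Unit).symm) c ↔ Compat mergeDiag a c := by
    simp only [compat_mergeDiag, Function.comp_apply, Equiv.sumComm_symm, Equiv.sumComm_apply,
      Sum.swap_inl, Sum.swap_inr]
    grind
  by_cases hc : Compat mergeDiag a c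
  · simp only [sem, ind, if_pos hc, if_pos (h.2 hc)]
  · simp only [sem, ind, if_neg hc, if_neg (mt h.1 hc)]

theorem Diag.partialClosure_mergeDiag :
    Diag.partialClosure (0, mergeDiag) = graph (Equiv.refl Unit) := by
  refine ext_sem fun X _ a c => ?_
  classical
  have := Fintype.ofFinite X
  rw [sem_partialClosure, sem_graph]
  simp only [sem, ind, compat_mergeDiag, pow_zero, one_mul, Sum.elim_inl, Sum.elim_inr]
  rw [Finset.sum_eq_single a]
  · by_cases h : a = c
    · subst h
      simp
    · rw [if_neg fun h' => h (funext fun _ => h'.2)]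
      exact (if_neg h).symm
  · intro b _ hb
    rw [if_neg]
    exact fun h => hb (funext fun _ => h.1.symm)
  · simp

theorem Diag.partialClosure_mergeDiag_swap :
    (Diag.comp (0, mergeDiag) (graph (Equiv.sumComm Unit Unit))).partialClosure = (0, ⊥) := by
  refine ext_sem fun X _ a c => ?_
  classical
  have := Fintype.ofFinite X
  rw [sem_partialClosure]
  simp only [sem_comp_graph]
  simp only [sem, ind, compat_mergeDiag, compat_bot, pow_zero, one_mul, if_true, Sum.elim_inl,
    Sum.elim_inr, Function.comp_apply, Equiv.sumComm_apply, Sum.swap_inl]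
  rw [Finset.sum_eq_single a]
  · exact if_pos ⟨rfl, rfl⟩
  · intro b _ hb
    rw [if_neg]
    exact fun h => hb (funext fun _ => h.1.symm)
  · simp

end PartitionDiagram

/-! ### Partial traces in ribbon categories -/

section PartialTrace

variable {C : Type u} [Category.{v} C] [MonoidalCategory C]

theorem evalTwisted_eq [SymmetricCategory C] [RightRigidCategory C] (W : C) :
    evalTwisted W = (β_ W Wᘁ).hom ≫ ε_ W Wᘁ := by
  simp [evalTwisted, RibbonCategory.twist]

variable [BraidedCategory C] [RightRigidCategory C] [RibbonCategory C]

theorem partialTraceRight_conj {V V' W : C} (r : V' ⟶ V) (f : V ⊗ W ⟶ V ⊗ W) (i : V ⟶ V') :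
    partialTraceRight ((r ▷ W) ≫ f ≫ (i ▷ W)) = r ≫ partialTraceRight f ≫ i := by
  simp only [partialTraceRight, comp_whiskerRight, Category.assoc, associator_naturality_left_assoc,
    ← whisker_exchange_assoc, MonoidalCategory.rightUnitor_naturality]
  rw [← associator_inv_naturality_left_assoc, whisker_exchange_assoc,
    ← rightUnitor_inv_naturality_assoc]

/-- A trace is compatible with retracts. -/
theorem ModifiedTrace.tr_conj {K : Type w} [Field K] [Preadditive C] [Linear K C]
    {I : ObjectIdeal C} (τ : ModifiedTrace K I) {V W : C} (hV : I.mem V) (hW : I.mem W)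
    (s : Retract V W) (f : V ⟶ V) : τ.tr W hW (s.r ≫ f ≫ s.i) = τ.tr V hV f := by
  rw [← Category.assoc, τ.tr_comm V W hV hW, ← Category.assoc, s.retract, Category.id_comp]

/-- A trace on the ideal generated by `J` is determined by its values on endomorphisms of `J`. -/
theorem ModifiedTrace.ext_of_tr_eq {K : Type w} [Field K] [Preadditive C] [Linear K C]
    {J : C} {σ τ : ModifiedTrace K (idealOf J)}
    (h : σ.tr J (mem_idealOf_self J) = τ.tr J (mem_idealOf_self J)) : σ = τ := by
  ext V hV f
  obtain ⟨X, ⟨s⟩⟩ := id hV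
  have hJ := mem_idealOf_self J
  rw [← σ.tr_conj hV ((idealOf J).tensor_mem hJ X) s, σ.tr_tensor J X hJ, h, ← τ.tr_tensor J X hJ,
    τ.tr_conj hV _ s]

variable [Preadditive C] [MonoidalPreadditive C]

theorem partialTraceRight_zero (V W : C) : partialTraceRight (0 : V ⊗ W ⟶ V ⊗ W) = 0 := by
  simp [partialTraceRight]

theorem partialTraceRight_add {V W : C} (f g : V ⊗ W ⟶ V ⊗ W) :
    partialTraceRight (f + g) = partialTraceRight f + partialTraceRight g := by
  simp [partialTraceRight]

theorem partialTraceRight_smul {K : Type w} [Field K] [Linear K C] [MonoidalLinear K C] {V W : C}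
    (a : K) (f : V ⊗ W ⟶ V ⊗ W) :
    partialTraceRight (a • f) = a • partialTraceRight f := by
  simp [partialTraceRight]

end PartialTrace

namespace RepZero

open PartitionDiagram

variable {F : Type u} [Field F] {t : F}

theorem partialTraceRight_diagLin (X Y : RepZero F t)
    (x : Diag (X.carrier ⊕ Y.carrier) (X.carrier ⊕ Y.carrier)) :
    partialTraceRight (V := X) (W := Y) (diagLin t x) = diagLin t x.partialClosure := by
  rw [partialTraceRight, evalTwisted_eq]
  change compLin t (graphLin F _) (compLin t (tensLin (graphLin F _) (Finsupp.single (cup _) 1))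
    (compLin t (graphLin F _) (compLin t (tensLin (diagLin t x) (graphLin F _))
    (compLin t (graphLin F _) (compLin t (tensLin (graphLin F _) (compLin t (graphLin F _)
      (Finsupp.single (cap _) 1))) (graphLin F _)))))) = _
  simp only [graphLin_eq t, single_eq t, tensLin_diagLin, compLin_diagLin]
  rfl

/-- Joining a part of the two rows before the rest does not change the closure of a diagram. The set
`X` has to be nonempty, as components lost in the first step have weight zero. -/
theorem closureTrace_partialTraceRight (X Y : RepZero F (0 : F)) [Nonempty X.carrier]
    (f : X ⊗ Y ⟶ X ⊗ Y) :
    closureTrace (F := F) (A := X.carrier) (partialTraceRight f) =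
      closureTrace (F := F) (A := X.carrier ⊕ Y.carrier) f := by
  have := Fintype.ofFinite (X.carrier → Bool)
  have := Fintype.ofFinite (Y.carrier → Bool)
  have := Fintype.ofFinite (X.carrier ⊕ Y.carrier → Bool)
  refine lin_induction (F := F) 0 (P := fun f => closureTrace (F := F) (A := X.carrier)
    (partialTraceRight (V := X) (W := Y) f) = closureTrace (F := F) f) f ?_ ?_ ?_ ?_
  · refine (congrArg (closureTrace (F := F) (A := X.carrier)) (partialTraceRight_zero X Y)).trans ?_
    exact (map_zero _).trans (map_zero _).symm
  · intro f g hf hg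
    refine (congrArg (closureTrace (F := F) (A := X.carrier))
      (partialTraceRight_add (V := X) (W := Y) f g)).trans ?_
    refine (map_add _ _ _).trans ?_
    rw [map_add, ← hf, ← hg]
  · intro a f hf
    refine (congrArg (closureTrace (F := F) (A := X.carrier))
      (partialTraceRight_smul (V := X) (W := Y) a f)).trans ?_
    refine (map_smul _ _ _).trans ?_
    rw [map_smul, ← hf]
  · intro x
    have : Nonempty (X ⊗ Y).carrier := inferInstanceAs (Nonempty (X.carrier ⊕ Y.carrier))
    have : Fintype ((X ⊗ Y).carrier → Bool) :=
      inferInstanceAs (Fintype (X.carrier ⊕ Y.carrier → Bool))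
    rw [partialTraceRight_diagLin, closureTrace_diagLin, closureTrace_diagLin]
    simp only [Diag.sem_partialClosure]
    congr 2
    rw [← Finset.sum_product', Finset.univ_product_univ]
    exact (Fintype.sum_equiv (Equiv.sumArrowEquivProdArrow X.carrier Y.carrier Bool) _ _
      fun z => by simp [Equiv.sumArrowEquivProdArrow]).symm

end RepZero

/-! ### Partial traces in the additive and Karoubi envelopes -/

namespace AdditiveEnvelope

variable {C : Type u} [Category.{v} C] [Preadditive C] [MonoidalCategory C]
  [MonoidalPreadditive C] [SymmetricCategory C] [RightRigidCategory C]

/-- The diagonal entries of the matrix product that defines the partial trace are the sums of the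
partial traces of the diagonal blocks. -/
theorem mul_partialTraceRight {ι κ : Type} [Fintype ι] [Fintype κ] (X : ι → C) (Y : κ → C)
    (f : Mtx (tensFam X Y) (tensFam X Y)) (i : ι) :
    mul (rightInv X) (mul (tens (one X) (coev Y)) (mul (assocInv X Y (dualFam Y))
      (mul (tens f (one (dualFam Y))) (mul (assocHom X Y (dualFam Y))
        (mul (tens (one X) (mul (braidHom Y (dualFam Y)) (ev Y))) (rightHom X)))))) i i =
      ∑ j : κ, partialTraceRight (V := X i) (W := Y j) (f (i, j) (i, j)) := by
  classical
  -- The part of the product to the right of `f` is supported on `k.1.1 = i` and `k.1.2 = k.2`.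
  have hout : ∀ (k : (ι × κ) × κ), mul (assocHom X Y (dualFam Y))
      (mul (tens (one X) (mul (braidHom Y (dualFam Y)) (ev Y))) (rightHom X)) k i =
        (α_ (X k.1.1) (Y k.1.2) (Y k.2)ᘁ).hom ≫
          (one X k.1.1 i ⊗ₘ ((β_ (Y k.1.2) (Y k.2)ᘁ).hom ≫
            ev Y (k.2, k.1.2) PUnit.unit)) ≫ (ρ_ (X i)).hom := by
    intro k
    rw [assocHom, reindex_mul, rightHom]
    congr 1
    refine (mul_reindex (fun i : ι × PUnit.{1} => i.1) ((Equiv.prodPUnit ι).injective)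
      _ _ _ (i, PUnit.unit)).trans ?_
    simp only [tens, braidHom]
    rw [reindex_mul]
  rw [rightInv, reindex_mul, mul, ← Finset.sum_of_injOn
    (fun j : κ => ((i, (j, j)) : ι × (κ × κ))) (s := Finset.univ)
    (f := fun j => (X i ◁ η_ (Y j) (Y j)ᘁ) ≫
      mul (assocInv X Y (dualFam Y))
    (mul (tens f (one (dualFam Y))) (mul (assocHom X Y (dualFam Y))
      (mul (tens (one X) (mul (braidHom Y (dualFam Y)) (ev Y))) (rightHom X))))
      (i, (j, j)) i)]
  · rw [Preadditive.comp_sum]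
    refine Finset.sum_congr rfl fun j _ => ?_
    rw [assocInv, reindex_mul, mul, Finset.sum_eq_single ((i, j), j)]
    · rw [hout]
      simp only [tens, one_self, ev_self, partialTraceRight, evalTwisted_eq, tensorHom_id,
        id_tensorHom]
    · rintro ⟨⟨a, b⟩, c⟩ - hne
      rw [hout]
      simp only [tens]
      by_cases h1 : j = c
      · subst h1
        by_cases h2 : j = b
        · subst h2
          have h3 : a ≠ i := by
            rintro rfl
            exact hne rfl
          rw [one_of_ne _ h3]
          simp
        · rw [ev_of_ne _ h2]
          simp
      · rw [one_of_ne _ h1]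
        simp
    · simp
  · intro j _ j' _ h
    exact congrArg (fun k => k.2.1) h
  · simp
  · rintro ⟨a, b, c⟩ - hne
    simp only [tens]
    by_cases h1 : i = a
    · subst h1
      have h2 : b ≠ c := by
        rintro rfl
        exact hne ⟨b, by simp, rfl⟩
      rw [coev_of_ne _ h2]
      simp
    · rw [one_of_ne _ h1]
      simp
  · intro j _
    simp only [tens, one_self, coev_self, id_tensorHom]

theorem partialTraceRight_apply_self {M N : Mat_ C} (f : M ⊗ N ⟶ M ⊗ N) (i : M.ι) :
    (partialTraceRight f i i : M.X i ⟶ M.X i) =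
      ∑ j : N.ι, partialTraceRight (V := M.X i) (W := N.X j) (f (i, j) (i, j)) := by
  rw [partialTraceRight, evalTwisted_eq]
  exact mul_partialTraceRight M.X N.X f i

end AdditiveEnvelope

namespace KaroubiEnvelope
open Idempotents

variable {C : Type u} [Category.{v} C] [MonoidalCategory C]
  [SymmetricCategory C] [RightRigidCategory C]

/-- The idempotents that occur in the structure morphisms of the Karoubi envelope are absorbed by
`f`. -/
theorem partialTraceRight_f {P Q : Karoubi C} (f : P ⊗ Q ⟶ P ⊗ Q) :
    (partialTraceRight f).f = partialTraceRight (V := P.X) (W := Q.X) f.f := by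
  rw [partialTraceRight, evalTwisted_eq, partialTraceRight, evalTwisted_eq]
  change (P.p ≫ (ρ_ P.X).inv) ≫ (P.p ⊗ₘ (η_ Q.X Q.Xᘁ ≫ (Q.p ⊗ₘ Q.pᘁ))) ≫
    ((P.p ⊗ₘ (Q.p ⊗ₘ Q.pᘁ)) ≫ (α_ P.X Q.X Q.Xᘁ).inv) ≫ (f.f ⊗ₘ Q.pᘁ) ≫
    (((P.p ⊗ₘ Q.p) ⊗ₘ Q.pᘁ) ≫ (α_ P.X Q.X Q.Xᘁ).hom) ≫
    (P.p ⊗ₘ (((Q.p ⊗ₘ Q.pᘁ) ≫ (β_ Q.X Q.Xᘁ).hom) ≫ ((Q.pᘁ ⊗ₘ Q.p) ≫ ε_ Q.X Q.Xᘁ))) ≫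
    ((P.p ⊗ₘ 𝟙 (𝟙_ C)) ≫ (ρ_ P.X).hom) = _
  have i₁ : Q.pᘁ ≫ Q.pᘁ = Q.pᘁ := by rw [← comp_rightAdjointMate, Q.idem]
  have c : η_ Q.X Q.Xᘁ ≫ Q.X ◁ Q.pᘁ = η_ Q.X Q.Xᘁ ≫ Q.p ▷ Q.Xᘁ := by
    rw [coevaluation_comp_rightAdjointMate]
  obtain ⟨φ, hφ⟩ := f
  change (P.p ⊗ₘ Q.p) ≫ φ ≫ (P.p ⊗ₘ Q.p) = φ at hφ
  have e : (P.p ⊗ₘ Q.p) ≫ (P.p ⊗ₘ Q.p) = P.p ⊗ₘ Q.p := by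
    rw [MonoidalCategory.tensorHom_comp_tensorHom, P.idem, Q.idem]
  have hl : (P.X ◁ Q.p) ≫ φ = φ := by
    rw [← hφ, ← id_tensorHom, MonoidalCategory.tensorHom_comp_tensorHom_assoc, Q.idem,
      Category.id_comp]
  have hl' : (P.p ⊗ₘ Q.p) ≫ φ = φ := by rw [← hφ, reassoc_of% e]
  have hr : φ ≫ (P.p ⊗ₘ Q.p) = φ := by
    conv_rhs => rw [← hφ]
    conv_lhs => rw [← hφ]
    simp only [Category.assoc, e]
  change _ ≫ _ ≫ _ ≫ (φ ⊗ₘ Q.pᘁ) ≫ _ = _ ≫ _ ≫ _ ≫ (φ ▷ Q.Xᘁ) ≫ _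
  set m := rightAdjointMate Q.p
  have s₁ : (P.p ≫ (ρ_ P.X).inv) ≫ (P.p ⊗ₘ (η_ Q.X Q.Xᘁ ≫ (Q.p ⊗ₘ m))) ≫
      (P.p ⊗ₘ (Q.p ⊗ₘ m)) ≫ (α_ P.X Q.X Q.Xᘁ).inv =
      (ρ_ P.X).inv ≫ P.X ◁ η_ Q.X Q.Xᘁ ≫ (α_ P.X Q.X Q.Xᘁ).inv ≫ ((P.p ⊗ₘ Q.p) ⊗ₘ m) := by
    rw [MonoidalCategory.rightUnitor_inv_naturality, ← tensorHom_id, Category.assoc,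
      MonoidalCategory.tensorHom_comp_tensorHom_assoc,
      MonoidalCategory.tensorHom_comp_tensorHom_assoc, ← associator_inv_naturality,
      ← id_tensorHom, MonoidalCategory.tensorHom_comp_tensorHom_assoc]
    simp only [Category.id_comp, Category.assoc, P.idem, Q.idem, i₁,
      MonoidalCategory.tensorHom_comp_tensorHom]
  have s₂ : ((P.p ⊗ₘ Q.p) ⊗ₘ m) ≫ (α_ P.X Q.X Q.Xᘁ).hom ≫
      (P.p ⊗ₘ (((Q.p ⊗ₘ m) ≫ (β_ Q.X Q.Xᘁ).hom) ≫ ((m ⊗ₘ Q.p) ≫ ε_ Q.X Q.Xᘁ))) ≫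
      ((P.p ⊗ₘ 𝟙 (𝟙_ C)) ≫ (ρ_ P.X).hom) =
      ((P.p ⊗ₘ Q.p) ⊗ₘ m) ≫ (α_ P.X Q.X Q.Xᘁ).hom ≫
        P.X ◁ ((β_ Q.X Q.Xᘁ).hom ≫ ε_ Q.X Q.Xᘁ) ≫ (ρ_ P.X).hom := by
    simp only [associator_naturality_assoc, ← id_tensorHom,
      MonoidalCategory.tensorHom_comp_tensorHom_assoc, Category.comp_id, P.idem, Category.assoc]
    simp only [← BraidedCategory.braiding_naturality_assoc,
      MonoidalCategory.tensorHom_comp_tensorHom_assoc, Q.idem, i₁]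
  -- The last idempotent, on the dual strand, slides along the coevaluation and is absorbed by `φ`.
  have s₃ : P.X ◁ η_ Q.X Q.Xᘁ ≫ (α_ P.X Q.X Q.Xᘁ).inv ≫ (φ ⊗ₘ m) =
      P.X ◁ η_ Q.X Q.Xᘁ ≫ (α_ P.X Q.X Q.Xᘁ).inv ≫ (φ ▷ Q.Xᘁ) := by
    rw [MonoidalCategory.tensorHom_def', ← associator_inv_naturality_right_assoc,
      ← whiskerLeft_comp_assoc, c, whiskerLeft_comp_assoc, associator_inv_naturality_middle_assoc,
      ← comp_whiskerRight, hl]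
  have s₄ : ((P.p ⊗ₘ Q.p) ⊗ₘ m) ≫ (φ ⊗ₘ m) = φ ⊗ₘ m := by
    rw [MonoidalCategory.tensorHom_comp_tensorHom, hl', i₁]
  have s₅ : (φ ⊗ₘ m) ≫ ((P.p ⊗ₘ Q.p) ⊗ₘ m) = φ ⊗ₘ m := by
    rw [MonoidalCategory.tensorHom_comp_tensorHom, hr, i₁]
  simp only [Category.assoc] at s₁ s₂ ⊢
  rw [s₂, reassoc_of% s₅, reassoc_of% s₁, reassoc_of% s₄, reassoc_of% s₃]

end KaroubiEnvelope

/-! ### The trace on objects without empty index sets -/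

namespace DeligneCat

open PartitionDiagram

variable {F : Type u} [Field F]

/-- The sum of the closure traces of the diagonal entries of the matrix underlying an endomorphism.
It is meaningful only when no index set is empty. -/
noncomputable def entryTrace (P : DeligneCat F (0 : F)) : (P ⟶ P) →ₗ[F] F where
  toFun f := ∑ i : P.X.ι, closureTrace (F := F) (A := (P.X.X i).carrier) (f.f i i)
  map_add' f g := by
    rw [← Finset.sum_add_distrib]
    exact Finset.sum_congr rfl fun i _ => map_add closureTrace _ _
  map_smul' a f := by
    rw [Finset.smul_sum]
    exact Finset.sum_congr rfl fun i _ => map_smul closureTrace a _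

/-- The object is a direct factor of a tuple of objects `[A]` with all the sets `A` nonempty. This
is a condition on the chosen presentation, which is not invariant under isomorphism. -/
def IsNonempty (P : DeligneCat F (0 : F)) : Prop := ∀ i : P.X.ι, Nonempty (P.X.X i).carrier

theorem IsNonempty.tensor {P : DeligneCat F (0 : F)} (hP : P.IsNonempty)
    (Q : DeligneCat F (0 : F)) : IsNonempty (P ⊗ Q) := fun i => by
  have := hP i.1
  exact inferInstanceAs (Nonempty ((P.X.X i.1).carrier ⊕ (Q.X.X i.2).carrier))

theorem entryTrace_comm {P Q : DeligneCat F (0 : F)} (hP : P.IsNonempty) (hQ : Q.IsNonempty)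
    (f : P ⟶ Q) (g : Q ⟶ P) : entryTrace P (f ≫ g) = entryTrace Q (g ≫ f) := by
  have h : ∀ {P Q : DeligneCat F (0 : F)} (f : P ⟶ Q) (g : Q ⟶ P), entryTrace P (f ≫ g) =
      ∑ i : P.X.ι, ∑ j : Q.X.ι, closureTrace (F := F) (A := (P.X.X i).carrier)
        (f.f i j ≫ g.f j i) := fun {P Q} f g =>
    Finset.sum_congr rfl fun i _ => map_sum (closureTrace (F := F) (A := (P.X.X i).carrier))
      (fun j : Q.X.ι => f.f i j ≫ g.f j i) Finset.univ
  rw [h, h, Finset.sum_comm]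
  refine Finset.sum_congr rfl fun j _ => Finset.sum_congr rfl fun i _ => ?_
  have := hP i
  have := hQ j
  exact closureTrace_compLin_comm _ _

theorem entryTrace_tensor {P : DeligneCat F (0 : F)} (hP : P.IsNonempty) (Q : DeligneCat F (0 : F))
    (f : P ⊗ Q ⟶ P ⊗ Q) : entryTrace (P ⊗ Q) f = entryTrace P (partialTraceRight f) := by
  have h : ∀ i, closureTrace (F := F) (A := (P.X.X i).carrier) ((partialTraceRight f).f i i) =
      ∑ j : Q.X.ι, closureTrace (F := F) (A := (P.X.X i).carrier ⊕ (Q.X.X j).carrier)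
        (f.f (i, j) (i, j)) := by
    intro i
    have := hP i
    rw [KaroubiEnvelope.partialTraceRight_f]
    refine (congrArg _ (AdditiveEnvelope.partialTraceRight_apply_self
      (M := P.X) (N := Q.X) f.f i)).trans ?_
    refine (map_sum (closureTrace (F := F) (A := (P.X.X i).carrier)) _ _).trans ?_
    exact Finset.sum_congr rfl fun j _ => RepZero.closureTrace_partialTraceRight _ _ _
  refine Eq.trans ?_ (Finset.sum_congr rfl fun i _ => (h i).symm)
  exact Fintype.sum_prod_type _

/-! ### Extension of the trace to retracts -/

section Existence

variable {I : ObjectIdeal (DeligneCat F (0 : F))}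

/-- The trace on a retract does not depend on the ambient object or on the retraction. -/
theorem entryTrace_retract {V P Q : DeligneCat F (0 : F)} (hP : P.IsNonempty) (hQ : Q.IsNonempty)
    (r : Retract V P) (s : Retract V Q) (f : V ⟶ V) :
    entryTrace P (r.r ≫ f ≫ r.i) = entryTrace Q (s.r ≫ f ≫ s.i) := by
  have h := entryTrace_comm hP hQ (r.r ≫ f ≫ s.i) (s.r ≫ r.i)
  simpa only [Category.assoc, s.retract_assoc, r.retract_assoc] using h

/-- The trace on an ideal all of whose objects are retracts of objects without empty index sets: an
endomorphism of a retract is extended to a chosen such object, and traced there. -/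
noncomputable def closureModifiedTrace (hI : ∀ V, I.mem V →
      ∃ P : DeligneCat F (0 : F), P.IsNonempty ∧ Nonempty (Retract V P)) :
    ModifiedTrace F I where
  tr V hV :=
    let s := (hI V hV).choose_spec.2.some
    { toFun f := entryTrace _ (s.r ≫ f ≫ s.i)
      map_add' f g := by rw [Preadditive.add_comp, Preadditive.comp_add, map_add]
      map_smul' a f := by rw [Linear.smul_comp, Linear.comp_smul, map_smul, RingHom.id_apply] }
  tr_tensor U W hU f := by
    have h₁ := (hI U hU).choose_spec
    have h₂ := (hI _ (I.tensor_mem hU W)).choose_spec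
    change entryTrace _ (h₂.2.some.r ≫ f ≫ h₂.2.some.i) =
      entryTrace _ (h₁.2.some.r ≫ partialTraceRight f ≫ h₁.2.some.i)
    let s : Retract (U ⊗ W) ((hI U hU).choose ⊗ W) := ⟨h₁.2.some.i ▷ W, h₁.2.some.r ▷ W, by
      rw [← comp_whiskerRight, h₁.2.some.retract, id_whiskerRight]⟩
    rw [entryTrace_retract h₂.1 (h₁.1.tensor W) _ s, entryTrace_tensor h₁.1]
    exact congrArg _ (partialTraceRight_conj _ _ _)
  tr_comm U V hU hV f g := by
    have h₁ := (hI U hU).choose_spec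
    have h₂ := (hI V hV).choose_spec
    have h := entryTrace_comm h₂.1 h₁.1 (h₂.2.some.r ≫ f ≫ h₁.2.some.i)
      (h₁.2.some.r ≫ g ≫ h₂.2.some.i)
    simp only [Category.assoc, h₁.2.some.retract_assoc, h₂.2.some.retract_assoc] at h
    change entryTrace _ (h₂.2.some.r ≫ (f ≫ g) ≫ h₂.2.some.i) =
      entryTrace _ (h₁.2.some.r ≫ (g ≫ f) ≫ h₁.2.some.i)
    simpa only [Category.assoc] using h

theorem closureModifiedTrace_tr (hI : ∀ V, I.mem V →
      ∃ P : DeligneCat F (0 : F), P.IsNonempty ∧ Nonempty (Retract V P))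
    {V P : DeligneCat F (0 : F)} (hV : I.mem V) (hP : P.IsNonempty) (s : Retract V P) (f : V ⟶ V) :
    (closureModifiedTrace hI).tr V hV f = entryTrace P (s.r ≫ f ≫ s.i) :=
  entryTrace_retract (hI V hV).choose_spec.1 hP _ s f

end Existence

/-! ### The object `[1]` and the uniqueness of the trace -/

theorem endo_pt_eq (f : pt F 0 ⟶ pt F 0) :
    f = RepZero.coeff f (graph (Equiv.refl Unit)) • 𝟙 (pt F 0) +
      RepZero.coeff f ⊥ • RepZero.diagram (pt F 0) (pt F 0) ⊥ :=
  lin_unit_eq f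

theorem diagram_bot_comp_self :
    RepZero.diagram (pt F 0) (pt F 0) ⊥ ≫ RepZero.diagram (pt F 0) (pt F 0) ⊥ = 0 := by
  change compLin (0 : F) (Finsupp.single ⊥ 1) (Finsupp.single ⊥ 1) = 0
  rw [single_eq (0 : F), compLin_diagLin, Diag.bot_comp_bot]
  simp [diagLin]

/-- As the disconnected diagram squares to zero, `End([1])` is local, and the only idempotent
outside its maximal ideal is the identity. -/
theorem eq_id_of_idem (e : pt F 0 ⟶ pt F 0) (he : e ≫ e = e)
    (h0 : RepZero.coeff e (graph (Equiv.refl Unit)) ≠ 0) : e = 𝟙 _ := by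
  have hc := endo_pt_eq e
  set a := RepZero.coeff e (graph (Equiv.refl Unit))
  set b := RepZero.coeff e ⊥
  have h2 : e ≫ e = (a * a) • 𝟙 (pt F 0) +
      (a * b + b * a) • RepZero.diagram (pt F 0) (pt F 0) ⊥ := by
    have hx := diagram_bot_comp_self (F := F)
    rw [hc]
    generalize RepZero.diagram (pt F 0) (pt F 0) ⊥ = x at hx
    simp only [Preadditive.add_comp, Preadditive.comp_add, Linear.smul_comp, Linear.comp_smul,
      Category.id_comp, Category.comp_id, hx, smul_zero, add_zero, smul_add, smul_smul,
      add_smul, add_assoc]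
  rw [he] at h2
  have h3 : a = a * a := (congrArg (RepZero.coeff · (graph (Equiv.refl Unit))) h2).trans
    (lin_unit_apply (F := F) (a * a) (a * b + b * a)).1
  have h4 : b = a * b + b * a := (congrArg (RepZero.coeff · ⊥) h2).trans
    (lin_unit_apply (F := F) (a * a) (a * b + b * a)).2
  have h5 : a = 1 := mul_left_cancel₀ h0 (by rw [← h3, mul_one])
  have h6 : b = 0 := by simpa [h5] using h4
  rw [hc, h5, h6]
  simp

variable (F) in
/-- The object `[1]` of Deligne's category. -/
noncomputable abbrev point : DeligneCat F (0 : F) := summand (pt F 0) (𝟙 _) (Category.id_comp _)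

theorem p_comp_comp_p {C : Type u} [Category.{v} C] {P : Idempotents.Karoubi C} (h : P.p = 𝟙 _)
    (f : P.X ⟶ P.X) : P.p ≫ f ≫ P.p = f := by
  rw [h, Category.id_comp, Category.comp_id]

/-- Endomorphisms of `[1]` as endomorphisms of its image in Deligne's category. -/
noncomputable def pointEnd : (pt F 0 ⟶ pt F 0) →ₗ[F] (point F ⟶ point F) where
  toFun g := ⟨fun _ _ => g, by
    exact p_comp_comp_p ((Mat_.embedding _).map_id _) _⟩
  map_add' _ _ := rfl
  map_smul' _ _ := rfl

theorem pointEnd_surjective : Function.Surjective (pointEnd (F := F)) :=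
  fun f => ⟨f.f PUnit.unit PUnit.unit, rfl⟩

theorem pointEnd_id : pointEnd (𝟙 (pt F 0)) = 𝟙 (point F) := rfl

/-- Endomorphisms of `[1] ⊗ [1]` as endomorphisms of its image in Deligne's category. -/
noncomputable def pointSqEnd (g : pt F 0 ⊗ pt F 0 ⟶ pt F 0 ⊗ pt F 0) :
    point F ⊗ point F ⟶ point F ⊗ point F :=
  ⟨fun _ _ => g, by
    have h : (point F ⊗ point F).p = 𝟙 _ := by
      have h₁ : (point F).p = 𝟙 _ := (Mat_.embedding _).map_id _
      rw [KaroubiEnvelope.tensor_p, h₁]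
      exact id_tensorHom_id _ _
    exact p_comp_comp_p h _⟩

theorem pointSqEnd_comp (g h : pt F 0 ⊗ pt F 0 ⟶ pt F 0 ⊗ pt F 0) :
    pointSqEnd (g ≫ h) = pointSqEnd g ≫ pointSqEnd h := by
  refine Idempotents.Karoubi.hom_ext _ _ ?_
  funext i j
  exact (Fintype.sum_subsingleton (fun _ : PUnit.{1} × PUnit.{1} => g ≫ h) i).symm

theorem partialTraceRight_pointSqEnd (g : pt F 0 ⊗ pt F 0 ⟶ pt F 0 ⊗ pt F 0) :
    partialTraceRight (pointSqEnd g) = pointEnd (partialTraceRight g) := by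
  refine Idempotents.Karoubi.hom_ext _ _ ?_
  rw [KaroubiEnvelope.partialTraceRight_f]
  funext i j
  obtain rfl : i = j := rfl
  refine (AdditiveEnvelope.partialTraceRight_apply_self _ i).trans ?_
  exact Fintype.sum_subsingleton (ι := PUnit.{1}) _ i

theorem isNonempty_point : (point F).IsNonempty := fun _ => inferInstanceAs (Nonempty Unit)

theorem entryTrace_id_point : entryTrace (point F) (𝟙 _) = 1 := by
  classical
  refine (Fintype.sum_subsingleton (fun _ : PUnit.{1} =>
    closureTrace (F := F) (graphLin F (Equiv.refl Unit))) PUnit.unit).trans ?_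
  rw [graphLin_eq (0 : F), closureTrace_diagLin, if_pos]
  simp [Diag.sem_graph]

/-- Every trace takes the same value at the disconnected diagram and at the identity of `[1]`. With
`g` the diagram `mergeDiag` and `s` the swap, these are the partial traces of `g ≫ s` and of
`s ≫ g = g`, so cyclicity gives the claim. -/
theorem tr_pointEnd_bot {I : ObjectIdeal (DeligneCat F (0 : F))} (τ : ModifiedTrace F I)
    (h : I.mem (point F)) :
    τ.tr _ h (pointEnd (RepZero.diagram (pt F 0) (pt F 0) ⊥)) = τ.tr _ h (𝟙 _) := by
  let g : pt F 0 ⊗ pt F 0 ⟶ pt F 0 ⊗ pt F 0 := RepZero.diagram _ _ mergeDiag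
  let s : pt F 0 ⊗ pt F 0 ⟶ pt F 0 ⊗ pt F 0 := (β_ (pt F 0) (pt F 0)).hom
  have hs : s ≫ g = g := by
    change compLin (0 : F) (graphLin F (Equiv.sumComm Unit Unit)) (Finsupp.single mergeDiag 1) =
      Finsupp.single mergeDiag 1
    rw [graphLin_eq (0 : F), single_eq (0 : F), compLin_diagLin, Diag.swap_comp_mergeDiag]
  have h₁ : partialTraceRight g = 𝟙 _ := by
    have hg : g = diagLin (0 : F) (0, mergeDiag) := single_eq (0 : F) _
    rw [hg, RepZero.partialTraceRight_diagLin]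
    refine (congrArg (diagLin (0 : F)) Diag.partialClosure_mergeDiag).trans ?_
    exact (graphLin_eq (0 : F) _).symm
  have h₂ : partialTraceRight (g ≫ s) = RepZero.diagram (pt F 0) (pt F 0) ⊥ := by
    have hg : g ≫ s = diagLin (0 : F)
        (Diag.comp (0, mergeDiag) (Diag.graph (Equiv.sumComm Unit Unit))) := by
      change compLin (0 : F) (Finsupp.single mergeDiag 1) (graphLin F (Equiv.sumComm Unit Unit)) = _
      rw [graphLin_eq (0 : F), single_eq (0 : F), compLin_diagLin]
    rw [hg, RepZero.partialTraceRight_diagLin]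
    refine (congrArg (diagLin (0 : F)) Diag.partialClosure_mergeDiag_swap).trans ?_
    exact (single_eq (0 : F) _).symm
  rw [← h₂, ← partialTraceRight_pointSqEnd, ← τ.tr_tensor _ _ h, pointSqEnd_comp,
    τ.tr_comm _ _ (I.tensor_mem h _), ← pointSqEnd_comp, hs, τ.tr_tensor _ _ h,
    partialTraceRight_pointSqEnd, h₁, pointEnd_id]

theorem tr_point {I : ObjectIdeal (DeligneCat F (0 : F))} (τ : ModifiedTrace F I)
    (h : I.mem (point F)) (f : pt F 0 ⟶ pt F 0) :
    τ.tr _ h (pointEnd f) =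
      (RepZero.coeff f (graph (Equiv.refl Unit)) + RepZero.coeff f ⊥) * τ.tr _ h (𝟙 _) := by
  conv_lhs => rw [endo_pt_eq f]
  rw [map_add, map_add, map_smul, map_smul, map_smul, map_smul, tr_pointEnd_bot, pointEnd_id,
    smul_eq_mul, smul_eq_mul, add_mul]

theorem IsLBox.nonempty_iso_point {L : DeligneCat F (0 : F)} (hL : IsLBox L) :
    Nonempty (L ≅ point F) := by
  obtain ⟨e, he, h0, φ⟩ := hL
  obtain rfl := eq_id_of_idem e he.2.1 h0
  exact φ

end DeligneCat

open PartitionDiagram DeligneCat in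
theorem theorem4p1 (F : Type u) [Field F] [CharZero F] (L : DeligneCat F (0 : F))
    (hL : DeligneCat.IsLBox L) :
    ∃! τ : ModifiedTrace F (idealOf L), τ.tr L (mem_idealOf_self L) (𝟙 L) = 1 := by
  obtain ⟨φ⟩ := hL.nonempty_iso_point
  have hI : ∀ V, (idealOf L).mem V →
      ∃ P : DeligneCat F (0 : F), P.IsNonempty ∧ Nonempty (Retract V P) := by
    rintro V ⟨X, ⟨s⟩⟩
    exact ⟨point F ⊗ X, isNonempty_point.tensor X, ⟨s.trans (.ofIso (whiskerRightIso φ X))⟩⟩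
  have hL' := mem_idealOf_self L
  have hp : (idealOf L).mem (point F) := (idealOf L).retract_mem hL' (.ofIso φ.symm)
  have hone : (closureModifiedTrace hI).tr L hL' (𝟙 L) = 1 := by
    rw [closureModifiedTrace_tr hI hL' isNonempty_point (.ofIso φ)]
    refine Eq.trans (congrArg _ ?_) entryTrace_id_point
    change φ.inv ≫ 𝟙 L ≫ φ.hom = 𝟙 _
    rw [Category.id_comp, φ.inv_hom_id]
  refine ⟨closureModifiedTrace hI, hone, fun τ hτ => ?_⟩
  -- A normalized trace is read off on `End(L)` from the two coefficients of the matching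
  -- endomorphism of `[1]`.
  have key : ∀ (σ : ModifiedTrace F (idealOf L)), σ.tr L hL' (𝟙 L) = 1 → ∀ f : L ⟶ L, ∀ g,
      pointEnd g = φ.inv ≫ f ≫ φ.hom → σ.tr L hL' f =
        RepZero.coeff g (graph (Equiv.refl Unit)) + RepZero.coeff g ⊥ := by
    intro σ hσ f g hg
    have h1 : σ.tr _ hp (𝟙 _) = 1 := by
      rw [← hσ, ← σ.tr_conj hL' hp (.ofIso φ)]
      congr 1
      change _ = φ.inv ≫ 𝟙 L ≫ φ.hom
      rw [Category.id_comp, φ.inv_hom_id]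
    rw [← σ.tr_conj hL' hp (.ofIso φ), ← mul_one (_ + _), ← h1, ← tr_point, hg]
    rfl
  refine ModifiedTrace.ext_of_tr_eq (LinearMap.ext fun f => ?_)
  obtain ⟨g, hg⟩ := pointEnd_surjective (φ.inv ≫ f ≫ φ.hom)
  rw [key τ hτ f g hg, key _ hone f g hg]
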